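/- Let $D$ be the open unit disk of $\mathbb C$, $dA$ the normalized area measure on $D$, and $\varphi_a(z)=(a-z)/(1-\bar a z)$ for $a\in D$. Let $p>0$, $s>0$ and $\alpha>1$ with $s+p\alpha>1$, and let $\mu$ be a finite positive Borel measure on $D$. For $\gamma>-1$ let $D^p_\gamma$ be the space of all analytic functions $f$ on $D$ with $$\|f\|_{D^p_\gamma}=|f(0)|+\Big(\int_D|f'(z)|^p(\gamma+1)(1-|z|^2)^\gamma\,dA(z)\Big)^{1/p}<\infty .$$ The measure $\mu$ is a Carleson measure for $D^p_\gamma$ if there is a constant $C>0$ with $\int_D|f|^p\,d\mu\le C\|f\|^p_{D^p_\gamma}$ for all $f\in D^p_\gamma$. For $q>-2$ let $F(p,q,s)$ be the space of all analytic functions $f$ on $D$ with $$\|f\|^p_{F(p,q,s)}=\sup_{a\in D}\int_D|f'(z)|^p(1-|z|^2)^q(1-|\varphi_a(z)|^2)^s\,dA(z)<\infty ,$$ and put $|||f|||_{F(p,q,s)}=|f(0)|+\|f\|_{F(p,q,s)}$. For an arc $I\subset\partial D$ let $|I|$ be its normalized length ($|\partial D|=1$) and $S(I)=\{z:\ 1-|I|<|z|<1,\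 z/|z|\in I\}$. Let $T^\infty_{p,s}(\mu)$ be the space of all $\mu$-measurable functions $f$ on $D$ with $$\|f\|^p_{T^\infty_{p,s}(\mu)}=\sup_{I}|I|^{-s}\int_{S(I)}|f|^p\,d\mu<\infty ,$$ where the supremum is over all arcs $I\subset\partial D$ with $|I|>0$. If $\mu$ is a Carleson measure for $D^p_{s+p\alpha-2}$, then the embedding $F(p,p\alpha-2,s)\to T^\infty_{p,s}(\mu)$ is bounded; that is, $F(p,p\alpha-2,s)\subset T^\infty_{p,s}(\mu)$, and there is a constant $C\ge 0$ such that $$\|f\|_{T^\infty_{p,s}(\mu)}\le C\,|||f|||_{F(p,p\alpha-2,s)}\qquad\text{for all } f\in F(p,p\alpha-2,s).$$ -/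

import Mathlib

open MeasureTheory
open scoped ENNReal NNReal

noncomputable section

namespace DiskSpaces

/-- The open unit disk `D` of the complex plane. -/
def disk : Set ℂ := Metric.ball 0 1

/-- The normalized area measure `dA` on the unit disk, so that `A(D) = 1`. -/
def areaMeasure : Measure ℂ := (ENNReal.ofReal Real.pi)⁻¹ • (volume.restrict disk)

/-- The Möbius map `φ_a(z) = (a - z) / (1 - conj a * z)` of the disk. -/
def moebius (a z : ℂ) : ℂ := (a - z) / (1 - (starRingEnd ℂ) a * z)

/-- The space `H(D)` of analytic functions on the disk
(only the values on `disk` matter in everything below). -/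
def holo : Set (ℂ → ℂ) := {f | DifferentiableOn ℂ f disk}

/-! ### Weighted Dirichlet spaces -/

/-- `∫_D |f'|^p dA_γ`, where `dA_γ(z) = (γ + 1) (1 - |z|^2)^γ dA(z)`, `γ > -1`. -/
def dirichletIntegral (p γ : ℝ) (f : ℂ → ℂ) : ℝ≥0∞ :=
  ∫⁻ z in disk, ‖deriv f z‖ₑ ^ p * ENNReal.ofReal ((γ + 1) * (1 - ‖z‖ ^ 2) ^ γ) ∂areaMeasure

/-- `‖f‖_{D^p_γ} = |f(0)| + (∫_D |f'|^p dA_γ)^{1/p}`, with values in `[0, ∞]`. -/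
def dirichletNorm (p γ : ℝ) (f : ℂ → ℂ) : ℝ≥0∞ :=
  ‖f 0‖ₑ + dirichletIntegral p γ f ^ (1 / p)

/-- The weighted Dirichlet space `D^p_γ`. -/
def dirichletSpace (p γ : ℝ) : Set (ℂ → ℂ) :=
  {f | f ∈ holo ∧ dirichletNorm p γ f < ∞}

/-- `μ` is a Carleson measure for `D^p_γ`:
`∫_D |f|^p dμ ≤ C ‖f‖^p_{D^p_γ}` for all `f ∈ D^p_γ`. -/
def IsCarlesonDirichlet (p γ : ℝ) (μ : Measure ℂ) : Prop :=
  ∃ C : ℝ≥0, ∀ f ∈ dirichletSpace p γ,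
    ∫⁻ z in disk, ‖f z‖ₑ ^ p ∂μ ≤ C * dirichletNorm p γ f ^ p

/-! ### The spaces `F(p, q, s)` -/

/-- `∫_D |f'(z)|^p (1 - |z|^2)^q (1 - |φ_a(z)|^2)^s dA(z)`. -/
def fIntegral (p q s : ℝ) (f : ℂ → ℂ) (a : ℂ) : ℝ≥0∞ :=
  ∫⁻ z in disk, ‖deriv f z‖ₑ ^ p *
    ENNReal.ofReal ((1 - ‖z‖ ^ 2) ^ q * (1 - ‖moebius a z‖ ^ 2) ^ s) ∂areaMeasure

/-- `‖f‖_{F(p,q,s)}`: the `p`-th root of the supremum over `a ∈ D` of the integrals above. -/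
def fSeminorm (p q s : ℝ) (f : ℂ → ℂ) : ℝ≥0∞ :=
  (⨆ a ∈ disk, fIntegral p q s f a) ^ (1 / p)

/-- `|‖f‖|_{F(p,q,s)} = |f(0)| + ‖f‖_{F(p,q,s)}`. -/
def fNorm (p q s : ℝ) (f : ℂ → ℂ) : ℝ≥0∞ := ‖f 0‖ₑ + fSeminorm p q s f

/-- The space `F(p,q,s)`. -/
def fSpace (p q s : ℝ) : Set (ℂ → ℂ) := {f | f ∈ holo ∧ fSeminorm p q s f < ∞}

/-! ### Tent-type spaces -/

/-- The closed arc of the unit circle that starts at `exp (i θ)` and has normalized length `h`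
(for `0 < h ≤ 1`; the whole circle has length `1`). -/
def arc (θ h : ℝ) : Set ℂ :=
  (fun t : ℝ => Complex.exp (t * Complex.I)) '' Set.Icc θ (θ + 2 * Real.pi * h)

/-- The Carleson box `S(I) = {z : 1 - |I| < |z| < 1, z / |z| ∈ I}` of the arc `I = arc θ h`. -/
def carlesonBox (θ h : ℝ) : Set ℂ :=
  {z | 1 - h < ‖z‖ ∧ ‖z‖ < 1 ∧ z / (‖z‖ : ℂ) ∈ arc θ h}

/-- `‖f‖_{T^∞_{p,s}(μ)} = (sup_I |I|^{-s} ∫_{S(I)} |f|^p dμ)^{1/p}`, the supremum being over the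
closed arcs of positive length. An arc without one or both endpoints lies in the closed arc of the
same length, so admitting such arcs would not change the supremum. -/
def tentNorm (p s : ℝ) (μ : Measure ℂ) (f : ℂ → ℂ) : ℝ≥0∞ :=
  (⨆ (θ : ℝ) (h ∈ Set.Ioc (0 : ℝ) 1),
    ENNReal.ofReal (h ^ (-s)) * ∫⁻ z in carlesonBox θ h, ‖f z‖ₑ ^ p ∂μ) ^ (1 / p)

/-- The tent-type space `T^∞_{p,s}(μ)`. -/
def tentSpace (p s : ℝ) (μ : Measure ℂ) : Set (ℂ → ℂ) :=
  {f | AEMeasurable f (μ.restrict disk) ∧ tentNorm p s μ f < ∞}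

/-- The embedding `I : F(p,q,s) → T^∞_{p,s}(μ)` is (well defined and) bounded. -/
def IsBoundedEmbedding (p q s : ℝ) (μ : Measure ℂ) : Prop :=
  ∃ C : ℝ≥0, ∀ f ∈ fSpace p q s,
    f ∈ tentSpace p s μ ∧ tentNorm p s μ f ≤ C * fNorm p q s f

end DiskSpaces

end

noncomputable section

namespace DiskSpaces

/-! The Carleson hypothesis is tested on F(z) = f(z) / (1 - conj a z)^n, where a = `boxPoint θ h`
has modulus 1 - h and lies over an endpoint of the arc, and n p ≥ 2(s + pα). On the box |1 - conj a
z| ≤ 10h, so ∫_{S(I)} |f|^p dμ is at most (10h)^{np} ∫ |F|^p dμ. It therefore suffices that ‖F‖^p in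
D^p_{s+pα-2} is O((1 - |a|²)^{s-np}) |||f|||^p (`exists_dirichletNorm_div_pow_le`); the powers of h
then cancel against h^{-s}.

F' has two terms. The one with f' is controlled directly by the F-seminorm at a, because 1 -
|φ_a(z)|² = (1-|a|²)(1-|z|²)/|1 - conj a z|² (`lintegral_deriv_ker_le`). The one with f requires
`exists_lintegral_rpow_ker_le`, a bound for ∫ |f|^p (1-|z|²)^{s+pα-2} |1 - conj a z|^{-c} dA.

Since α > 1, integrating the α-Bloch growth of f' gives |f|^p = O((1-|z|²)^{p-pα}). If p > 1, this
and a Forelli–Rudin integral suffice, because s + p - 2 > -1. If p ≤ 1 that exponent may be too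
small. The substitution z = φ_a(w) and a Hardy–Littlewood inequality for f ∘ φ_a are used instead:
the value at 0 is f(a), bounded by growth, and the derivative integral is again controlled by the
F-seminorm. -/

/-! ### Weight, kernel and Möbius identities -/

/-- The weight `1 - |z|^2`. -/
def wt (z : ℂ) : ℝ := 1 - ‖z‖ ^ 2

/-- The modulus `|1 - conj a * z|`. -/
def ker (a z : ℂ) : ℝ := ‖1 - (starRingEnd ℂ) a * z‖

lemma mem_disk {z : ℂ} : z ∈ disk ↔ ‖z‖ < 1 := by simp [disk]

lemma measurableSet_disk : MeasurableSet disk := Metric.isOpen_ball.measurableSet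

lemma isOpen_disk : IsOpen disk := Metric.isOpen_ball

lemma wt_pos {z : ℂ} (hz : z ∈ disk) : 0 < wt z := by
  rw [mem_disk] at hz
  have := norm_nonneg z
  unfold wt; nlinarith

lemma wt_le_one (z : ℂ) : wt z ≤ 1 := by
  unfold wt; nlinarith [sq_nonneg ‖z‖]

lemma ker_comm (a z : ℂ) : ker a z = ker z a := by
  unfold ker
  rw [← Complex.norm_conj]
  simp [mul_comm]

lemma one_sub_norm_mul_le_ker (a z : ℂ) : 1 - ‖a‖ * ‖z‖ ≤ ker a z := by
  unfold ker
  have := norm_sub_norm_le (1 : ℂ) ((starRingEnd ℂ) a * z)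
  simpa using this

lemma ker_pos {a z : ℂ} (ha : a ∈ disk) (hz : z ∈ disk) : 0 < ker a z := by
  rw [mem_disk] at ha hz
  have := one_sub_norm_mul_le_ker a z
  nlinarith [norm_nonneg a, norm_nonneg z]

lemma ker_le_two {a z : ℂ} (ha : a ∈ disk) (hz : z ∈ disk) : ker a z ≤ 2 := by
  rw [mem_disk] at ha hz
  unfold ker
  have := norm_sub_le (1 : ℂ) ((starRingEnd ℂ) a * z)
  simp only [norm_one, norm_mul, Complex.norm_conj] at this
  nlinarith [norm_nonneg a, norm_nonneg z]

lemma wt_le_two_ker {a z : ℂ} (ha : a ∈ disk) (hz : z ∈ disk) : wt a ≤ 2 * ker a z := by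
  have h := one_sub_norm_mul_le_ker a z
  rw [mem_disk] at ha hz
  unfold wt
  nlinarith [norm_nonneg a, norm_nonneg z]

lemma wt_le_two_ker' {a z : ℂ} (ha : a ∈ disk) (hz : z ∈ disk) : wt z ≤ 2 * ker a z := by
  rw [ker_comm]; exact wt_le_two_ker hz ha

lemma one_sub_conj_mul_ne_zero {a z : ℂ} (ha : a ∈ disk) (hz : z ∈ disk) :
    1 - (starRingEnd ℂ) a * z ≠ 0 := by
  have := ker_pos ha hz
  simpa [ker] using this

lemma ker_sq (a z : ℂ) : ker a z ^ 2 = ‖a - z‖ ^ 2 + wt a * wt z := by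
  unfold ker wt
  rw [← Complex.normSq_eq_norm_sq, ← Complex.normSq_eq_norm_sq, ← Complex.normSq_eq_norm_sq,
    ← Complex.normSq_eq_norm_sq]
  simp [Complex.normSq_apply]
  ring

lemma wt_moebius {a z : ℂ} (ha : a ∈ disk) (hz : z ∈ disk) :
    wt (moebius a z) = wt a * wt z / ker a z ^ 2 := by
  have h := ker_pos ha hz
  have h2 := ker_sq a z
  have : ‖moebius a z‖ = ‖a - z‖ / ker a z := by simp [moebius, ker]
  rw [wt, this]
  field_simp
  linarith

lemma moebius_mem_disk {a z : ℂ} (ha : a ∈ disk) (hz : z ∈ disk) : moebius a z ∈ disk := by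
  have h : 0 < wt (moebius a z) := by
    rw [wt_moebius ha hz]
    have := ker_pos ha hz
    have := wt_pos ha
    have := wt_pos hz
    positivity
  rw [mem_disk]
  unfold wt at h
  nlinarith [norm_nonneg (moebius a z)]

lemma one_sub_conj_mul_moebius {a z : ℂ} (ha : a ∈ disk) (hz : z ∈ disk) :
    1 - (starRingEnd ℂ) a * moebius a z = (wt a : ℂ) / (1 - (starRingEnd ℂ) a * z) := by
  have h := one_sub_conj_mul_ne_zero ha hz
  have h2 : (wt a : ℂ) = 1 - (starRingEnd ℂ) a * a := by
    rw [← Complex.normSq_eq_conj_mul_self, Complex.normSq_eq_norm_sq]; simp [wt]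
  rw [h2, moebius]
  field_simp
  ring

lemma ker_moebius {a z : ℂ} (ha : a ∈ disk) (hz : z ∈ disk) :
    ker a (moebius a z) = wt a / ker a z := by
  unfold ker
  rw [one_sub_conj_mul_moebius ha hz, norm_div, Complex.norm_real, Real.norm_eq_abs,
    abs_of_pos (wt_pos ha)]

lemma moebius_moebius {a z : ℂ} (ha : a ∈ disk) (hz : z ∈ disk) :
    moebius a (moebius a z) = z := by
  have h := one_sub_conj_mul_ne_zero ha hz
  have hw : (wt a : ℂ) ≠ 0 := by exact_mod_cast (wt_pos ha).ne'
  have h2 : (wt a : ℂ) = 1 - (starRingEnd ℂ) a * a := by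
    rw [← Complex.normSq_eq_conj_mul_self, Complex.normSq_eq_norm_sq]; simp [wt]
  rw [moebius, one_sub_conj_mul_moebius ha hz, div_div_eq_mul_div, div_eq_iff hw, h2]
  have h3 : moebius a z * (1 - (starRingEnd ℂ) a * z) = a - z := div_mul_cancel₀ _ h
  linear_combination -h3

lemma moebius_zero (a : ℂ) : moebius a 0 = a := by simp [moebius]

lemma hasDerivAt_moebius {a z : ℂ} (ha : a ∈ disk) (hz : z ∈ disk) :
    HasDerivAt (moebius a) (-(wt a : ℂ) / (1 - (starRingEnd ℂ) a * z) ^ 2) z := by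
  have h := one_sub_conj_mul_ne_zero ha hz
  have h2 : (wt a : ℂ) = 1 - (starRingEnd ℂ) a * a := by
    rw [← Complex.normSq_eq_conj_mul_self, Complex.normSq_eq_norm_sq]; simp [wt]
  have h1 := ((hasDerivAt_id z).const_sub a).div
    (((hasDerivAt_id z).const_mul ((starRingEnd ℂ) a)).const_sub 1) h
  convert! h1 using 1
  rw [h2]
  simp only [id]
  congr 1
  ring

lemma injOn_moebius {a : ℂ} (ha : a ∈ disk) : Set.InjOn (moebius a) disk := by
  intro z hz w hw h
  rw [← moebius_moebius ha hz, h, moebius_moebius ha hw]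

lemma image_moebius {a : ℂ} (ha : a ∈ disk) : moebius a '' disk = disk := by
  apply Set.Subset.antisymm
  · rintro _ ⟨z, hz, rfl⟩
    exact moebius_mem_disk ha hz
  · intro z hz
    exact ⟨_, moebius_mem_disk ha hz, moebius_moebius ha hz⟩

/-! ### Möbius change of variables -/

/-- The Jacobian of `moebius a`. -/
def jac (a z : ℂ) : ℝ := (wt a / ker a z ^ 2) ^ 2

instance : SFinite areaMeasure := by
  unfold areaMeasure; infer_instance

lemma setLIntegral_areaMeasure (F : ℂ → ℝ≥0∞) :
    ∫⁻ z in disk, F z ∂areaMeasure = (ENNReal.ofReal Real.pi)⁻¹ * ∫⁻ z in disk, F z := by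
  rw [areaMeasure, Measure.restrict_smul, Measure.restrict_restrict measurableSet_disk,
    Set.inter_self, lintegral_smul_measure, smul_eq_mul]

lemma lintegral_moebius {a : ℂ} (ha : a ∈ disk) (F : ℂ → ℝ≥0∞) :
    ∫⁻ z in disk, F z ∂areaMeasure
      = ∫⁻ w in disk, F (moebius a w) * ENNReal.ofReal (jac a w) ∂areaMeasure := by
  rw [setLIntegral_areaMeasure, setLIntegral_areaMeasure]
  congr 1
  conv_lhs => rw [← image_moebius ha]
  rw [lintegral_image_eq_lintegral_abs_det_fderiv_mul volume measurableSet_disk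
    (fun z hz => ((hasDerivAt_moebius ha hz).hasFDerivAt.restrictScalars ℝ).hasFDerivWithinAt)
    (injOn_moebius ha)]
  refine setLIntegral_congr_fun measurableSet_disk fun z hz => ?_
  rw [mul_comm]
  congr 2
  simp [ContinuousLinearMap.det, LinearMap.det_restrictScalars,
      Algebra.norm_complex_eq, Complex.normSq_eq_norm_sq, jac, ker,
      abs_of_pos (wt_pos ha)]
  rw [← div_pow, abs_of_nonneg (sq_nonneg _)]

/-! ### Subharmonicity of |H|^p -/

lemma enorm_rpow_eq_ofReal {p : ℝ} (hp : 0 ≤ p) (z : ℂ) :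
    ‖z‖ₑ ^ p = ENNReal.ofReal (‖z‖ ^ p) := by
  rw [← ENNReal.ofReal_rpow_of_nonneg (norm_nonneg z) hp, ofReal_norm]

/-- By Jensen's formula the two sides differ by a sum over the zeros u of H, with multiplicity, of
log(r/|u|) ≥ 0. -/
lemma log_norm_le_circleAverage_log_norm {H : ℂ → ℂ} {r : ℝ} (hr : 0 < r)
    (hH : AnalyticOnNhd ℂ H (Metric.closedBall 0 r)) (h0 : H 0 ≠ 0) :
    Real.log ‖H 0‖ ≤ Real.circleAverage (fun z => Real.log ‖H z‖) 0 r := by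
  have habs : |r| = r := abs_of_pos hr
  rw [AnalyticOnNhd.circleAverage_log_norm hr.ne' (by rwa [habs]) h0]
  have : 0 ≤ ∑ᶠ u, MeromorphicOn.divisor H (Metric.closedBall 0 |r|) u
      * Real.log (r * ‖(0 : ℂ) - u‖⁻¹) := by
    refine finsum_nonneg fun u => ?_
    by_cases hu : u ∈ Metric.closedBall (0 : ℂ) |r|
    · refine mul_nonneg (by exact_mod_cast
        (MeromorphicOn.AnalyticOnNhd.divisor_nonneg (habs.symm ▸ hH)) u) ?_
      -- At u = 0 the term vanishes through the conventions `0⁻¹ = 0` and `Real.log 0 = 0`.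
      rcases eq_or_ne u 0 with rfl | hu0
      · simp
      · apply Real.log_nonneg
        have : 0 < ‖u‖ := norm_pos_iff.2 hu0
        have h2 : ‖u‖ ≤ r := by simpa [habs] using hu
        rw [zero_sub, norm_neg, ← div_eq_mul_inv, one_le_div this]
        exact h2
    · rw [Function.locallyFinsuppWithin.apply_eq_zero_of_notMem _ hu]
      simp
  linarith

/-- The convexity inequality 1 + x ≤ e^x at x = p(log|H| - log M), M = |H(0)|, gives M^p (1 + x) ≤
|H|^p; averaging and the logarithmic case make the left side at least M^p. -/
lemma rpow_norm_le_circleAverage {H : ℂ → ℂ} {r p : ℝ} (hr : 0 < r) (hp : 0 < p)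
    (hH : AnalyticOnNhd ℂ H (Metric.closedBall 0 r)) :
    ‖H 0‖ ^ p ≤ Real.circleAverage (fun z => ‖H z‖ ^ p) 0 r := by
  have habs : |r| = r := abs_of_pos hr
  by_cases h0 : H 0 = 0
  · rw [h0, norm_zero, Real.zero_rpow hp.ne']
    exact Real.circleAverage_nonneg_of_nonneg fun z _ => by positivity
  set M := ‖H 0‖ with hM
  have hMpos : 0 < M := norm_pos_iff.2 h0
  have hsub : Metric.sphere (0 : ℂ) |r| ⊆ Metric.closedBall 0 r := by
    rw [habs]; exact Metric.sphere_subset_closedBall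
  set f₁ : ℂ → ℝ := fun z => M ^ p * (1 + p * (Real.log ‖H z‖ - Real.log M)) with hf₁
  -- At a zero of H the convention `Real.log 0 = 0` can make `f₁` positive while |H|^p = 0. Zeros
  -- form a negligible set for circle averages, so |H|^p is replaced there by `f₁`.
  set f₂ : ℂ → ℝ := fun z => if H z = 0 then f₁ z else ‖H z‖ ^ p with hf₂
  have hlogint : CircleIntegrable (fun z => Real.log ‖H z‖) 0 r :=
    MeromorphicOn.circleIntegrable_log_norm (hH.mono hsub).meromorphicOn
  have hcongr : (fun z => ‖H z‖ ^ p) =ᶠ[Filter.codiscreteWithin (Metric.sphere 0 |r|)] f₂ := by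
    have h1 : H ⁻¹' {0}ᶜ ∈ Filter.codiscreteWithin (Metric.closedBall (0 : ℂ) r) :=
      hH.preimage_zero_mem_codiscreteWithin h0 (by simp [hr.le])
        ⟨⟨0, by simp [hr.le]⟩, (convex_closedBall _ _).isPreconnected⟩
    filter_upwards [Filter.codiscreteWithin_mono hsub h1] with z hz
    have : H z ≠ 0 := by simpa using hz
    simp [hf₂, this]
  have hint2 : CircleIntegrable (fun z => ‖H z‖ ^ p) 0 r := by
    apply ContinuousOn.circleIntegrable hr.le
    refine ContinuousOn.rpow_const ?_ fun _ _ => Or.inr hp.le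
    exact (hH.continuousOn.mono Metric.sphere_subset_closedBall).norm
  rw [Real.circleAverage_congr_codiscreteWithin hcongr hr.ne']
  have hint1 : CircleIntegrable f₁ 0 r := by
    have h2 : IntervalIntegrable (fun θ => Real.log ‖H (circleMap 0 r θ)‖) volume 0
      (2 * Real.pi) := hlogint
    exact (intervalIntegrable_const.add
      ((h2.sub intervalIntegrable_const).const_mul p)).const_mul (M ^ p)
  have hav : Real.circleAverage f₁ 0 r
      = M ^ p * (1 + p * (Real.circleAverage (fun z => Real.log ‖H z‖) 0 r - Real.log M)) := by
    have h2 : IntervalIntegrable (fun θ => Real.log ‖H (circleMap 0 r θ)‖) volume 0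
      (2 * Real.pi) := hlogint
    have hpi := Real.pi_ne_zero
    simp only [Real.circleAverage_def, hf₁, smul_eq_mul, intervalIntegral.integral_const_mul]
    rw [intervalIntegral.integral_add intervalIntegrable_const
      ((h2.sub intervalIntegrable_const).const_mul p), intervalIntegral.integral_const_mul,
      intervalIntegral.integral_sub h2 intervalIntegrable_const]
    simp only [intervalIntegral.integral_const, smul_eq_mul]
    field_simp
    ring
  calc M ^ p ≤ Real.circleAverage f₁ 0 r := by
        rw [hav]
        have := log_norm_le_circleAverage_log_norm hr hH h0
        have h3 : 0 < M ^ p := by positivity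
        have h4 : 0 ≤ p * (Real.circleAverage (fun z => Real.log ‖H z‖) 0 r - Real.log M) :=
          mul_nonneg hp.le (by linarith)
        nlinarith
    _ ≤ _ := by
        refine Real.circleAverage_mono hint1 (hint2.congr_codiscreteWithin hcongr) fun z _ => ?_
        by_cases hz : H z = 0
        · simp [hf₂, hz]
        · have hzpos : 0 < ‖H z‖ := norm_pos_iff.2 hz
          simp only [hf₂, hz, if_false, hf₁]
          have h5 := Real.add_one_le_exp (p * (Real.log ‖H z‖ - Real.log M))
          have h6 : Real.exp (p * (Real.log ‖H z‖ - Real.log M)) = ‖H z‖ ^ p / M ^ p := by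
            rw [Real.rpow_def_of_pos hzpos, Real.rpow_def_of_pos hMpos, ← Real.exp_sub]
            congr 1; ring
          rw [h6, le_div_iff₀ (by positivity)] at h5
          linarith

lemma enorm_rpow_mul_le_lintegral_circle {H : ℂ → ℂ} {r p : ℝ} (hr : 0 < r) (hp : 0 < p)
    (hH : AnalyticOnNhd ℂ H (Metric.closedBall 0 r)) :
    ‖H 0‖ₑ ^ p * ENNReal.ofReal (2 * Real.pi)
      ≤ ∫⁻ θ in Set.Ioo (-Real.pi) Real.pi, ‖H (circleMap 0 r θ)‖ₑ ^ p := by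
  have h1 := rpow_norm_le_circleAverage hr hp hH
  have hc : Continuous fun θ => ‖H (circleMap 0 r θ)‖ ^ p := by
    refine Continuous.rpow_const ?_ fun _ => Or.inr hp.le
    refine (hH.continuousOn.comp_continuous (continuous_circleMap 0 r) fun θ => ?_).norm
    exact Metric.sphere_subset_closedBall (circleMap_mem_sphere 0 hr.le θ)
  have hpi := Real.pi_pos
  rw [Real.circleAverage_eq_integral_add (-Real.pi),
    intervalIntegral.integral_comp_add_right (fun θ => ‖H (circleMap 0 r θ)‖ ^ p),
    show 0 + -Real.pi = -Real.pi by ring, show 2 * Real.pi + -Real.pi = Real.pi by ring,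
    smul_eq_mul, ← div_eq_inv_mul, le_div_iff₀ (by positivity),
    intervalIntegral.integral_of_le (by linarith), ← setIntegral_congr_set Ioo_ae_eq_Ioc] at h1
  simp_rw [enorm_rpow_eq_ofReal hp.le]
  rw [← ENNReal.ofReal_mul (by positivity), ← ofReal_integral_eq_lintegral_ofReal]
  · exact ENNReal.ofReal_le_ofReal h1
  · exact (hc.integrableOn_Icc (a := -Real.pi) (b := Real.pi)).mono_set Set.Ioo_subset_Icc_self
  · exact Filter.Eventually.of_forall fun θ => by positivity

lemma lintegral_id_Ioo_half :
    ∫⁻ r in Set.Ioo (0 : ℝ) (1 / 2), ENNReal.ofReal r = ENNReal.ofReal (1 / 8) := by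
  rw [← ofReal_integral_eq_lintegral_ofReal, ← integral_Ioc_eq_integral_Ioo,
    ← intervalIntegral.integral_of_le (by norm_num), integral_id]
  · norm_num
  · exact (continuous_id.integrableOn_Icc (a := (0 : ℝ)) (b := 1 / 2)).mono_set
      Set.Ioo_subset_Icc_self
  · filter_upwards [ae_restrict_mem measurableSet_Ioo] with r hr using hr.1.le

lemma polar_symm_eq_circleMap (r θ : ℝ) : Complex.polarCoord.symm (r, θ) = circleMap 0 r θ := by
  simp [circleMap, Complex.exp_mul_I]

/-- Integrating the circle inequality against r dr over (0, 1/2) gives 2π · 1/8 = π/4, the area of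
the half-radius disk. -/
lemma enorm_rpow_mul_le_lintegral_half_disk {H : ℂ → ℂ} {p : ℝ} (hp : 0 < p)
    (hH : DifferentiableOn ℂ H disk) :
    ‖H 0‖ₑ ^ p * ENNReal.ofReal (Real.pi / 4)
      ≤ ∫⁻ z in Metric.ball (0 : ℂ) (1 / 2), ‖H z‖ₑ ^ p := by
  classical
  have hsub : Metric.ball (0 : ℂ) (1 / 2) ⊆ disk := Metric.ball_subset_ball (by norm_num)
  set G : ℂ → ℝ≥0∞ := (Metric.ball (0 : ℂ) (1 / 2)).indicator fun z => ‖H z‖ₑ ^ p with hG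
  have hGm : Measurable G := by
    have hc : ContinuousOn (fun z => ‖H z‖ₑ ^ p) (Metric.ball (0 : ℂ) (1 / 2)) :=
      (ENNReal.continuous_rpow_const.comp continuous_enorm).comp_continuousOn
        (hH.continuousOn.mono hsub)
    rw [hG, ← Set.piecewise_eq_indicator]
    exact hc.measurable_piecewise continuousOn_const Metric.isOpen_ball.measurableSet
  rw [← lintegral_indicator Metric.isOpen_ball.measurableSet, ← hG,
    ← Complex.lintegral_comp_polarCoord_symm, polarCoord_target,
    Measure.volume_eq_prod, ← Measure.prod_restrict, lintegral_prod]
  swap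
  · refine (Measurable.aemeasurable ?_)
    have : Measurable fun q : ℝ × ℝ => Complex.polarCoord.symm q := by
      have : (fun q : ℝ × ℝ => (Complex.polarCoord.symm q : ℂ))
          = fun q => q.1 * (Real.cos q.2 + Real.sin q.2 * Complex.I) := by
        ext q; simp
      rw [this]; fun_prop
    exact (ENNReal.measurable_ofReal.comp measurable_fst).smul (hGm.comp this)
  calc ‖H 0‖ₑ ^ p * ENNReal.ofReal (Real.pi / 4)
      = ∫⁻ r in Set.Ioo (0 : ℝ) (1 / 2),
          ENNReal.ofReal r * (‖H 0‖ₑ ^ p * ENNReal.ofReal (2 * Real.pi)) := by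
        rw [lintegral_mul_const _ ENNReal.measurable_ofReal, lintegral_id_Ioo_half,
          mul_left_comm, ← ENNReal.ofReal_mul (by norm_num)]
        congr 2; ring
    _ ≤ ∫⁻ r in Set.Ioo (0 : ℝ) (1 / 2), ∫⁻ θ in Set.Ioo (-Real.pi) Real.pi,
          ENNReal.ofReal r • G (Complex.polarCoord.symm (r, θ)) := by
        refine setLIntegral_mono' measurableSet_Ioo fun r hr => ?_
        simp only [smul_eq_mul]
        rw [lintegral_const_mul' _ _ ENNReal.ofReal_ne_top]
        gcongr
        have hcb : Metric.closedBall (0 : ℂ) r ⊆ disk := by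
          apply Metric.closedBall_subset_ball; linarith [hr.2]
        refine (enorm_rpow_mul_le_lintegral_circle hr.1 hp
          ((hH.analyticOnNhd isOpen_disk).mono hcb)).trans (le_of_eq ?_)
        refine lintegral_congr fun θ => ?_
        rw [polar_symm_eq_circleMap, hG, Set.indicator_of_mem]
        simpa [abs_of_pos hr.1] using hr.2
    _ ≤ _ := lintegral_mono_set fun r hr => hr.1

/-! ### Weighted sub-mean values and Forelli–Rudin integrals -/

/-- In polar coordinates 1 - r² = (1 + r)(1 - r), where (1 + r)^γ ≤ 2^{|γ|} and (1 - r)^γ is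
integrable because γ > -1. -/
lemma lintegral_wt_rpow_lt_top {γ : ℝ} (hγ : -1 < γ) :
    ∫⁻ z in disk, ENNReal.ofReal (wt z ^ γ) ∂areaMeasure < ∞ := by
  rw [setLIntegral_areaMeasure]
  refine ENNReal.mul_lt_top (by simp [Real.pi_pos]) ?_
  have h : IntegrableOn (fun z : ℂ => (1 - ‖z‖ ^ 2) ^ γ) (Metric.ball 0 1) := by
    rw [integrableOn_fun_norm_addHaar volume (f := fun r : ℝ => (1 - r ^ 2) ^ γ)]
    have h1 : IntegrableOn (fun r : ℝ => (1 - r) ^ γ) (Set.Ioo 0 1) := by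
      have := (intervalIntegral.intervalIntegrable_rpow' hγ (a := 0) (b := 1)).comp_sub_left 1
      rw [sub_zero, sub_self] at this
      exact (this.symm.1).mono_set Set.Ioo_subset_Ioc_self
    have h2 : IntegrableOn (fun r : ℝ => 2 ^ |γ| * (1 - r) ^ γ) (Set.Ioo 0 1) := h1.const_mul _
    refine Integrable.mono' h2 (Measurable.aestronglyMeasurable (by fun_prop)) ?_
    filter_upwards [ae_restrict_mem measurableSet_Ioo] with r hr
    have hr1 : 0 < 1 - r := by linarith [hr.2]
    have e : 1 - r ^ 2 = (1 + r) * (1 - r) := by ring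
    rw [Complex.finrank_real_complex, e, Real.mul_rpow (by linarith [hr.1]) hr1.le]
    have h3 : (1 + r) ^ γ ≤ 2 ^ |γ| :=
      (Real.rpow_le_rpow_of_exponent_le (by linarith [hr.1]) (le_abs_self γ)).trans
        (Real.rpow_le_rpow (by linarith [hr.1]) (by linarith [hr.2]) (abs_nonneg γ))
    have h4 : 0 ≤ (1 - r) ^ γ := by positivity
    have h5 : 0 ≤ (1 + r) ^ γ := Real.rpow_nonneg (by linarith [hr.1]) _
    rw [Real.norm_of_nonneg (smul_nonneg (pow_nonneg hr.1.le _) (mul_nonneg h5 h4)), smul_eq_mul]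
    calc r ^ (2 - 1) * ((1 + r) ^ γ * (1 - r) ^ γ) ≤ 1 * (2 ^ |γ| * (1 - r) ^ γ) := by
          gcongr
          · simpa using hr.2.le
      _ = _ := one_mul _
  exact h.lintegral_lt_top

/-- Writing positive bases as exponentials turns identities between real powers into polynomial
identities in the exponents, which `ring` proves. -/
lemma exists_exp_eq {x : ℝ} (hx : 0 < x) : ∃ X, x = Real.exp X := ⟨_, (Real.exp_log hx).symm⟩

lemma jac_mul_rpow {x y k : ℝ} (hx : 0 < x) (hy : 0 < y) (hk : 0 < k) (κ : ℝ) :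
    (x * y / k ^ 2) ^ κ * (x / k ^ 2) ^ 2 = x ^ (κ + 2) * y ^ κ * k ^ (-2 * κ - 4) := by
  obtain ⟨X, rfl⟩ := exists_exp_eq hx
  obtain ⟨Y, rfl⟩ := exists_exp_eq hy
  obtain ⟨K, rfl⟩ := exists_exp_eq hk
  simp only [← Real.exp_nat_mul, ← Real.exp_add, ← Real.exp_sub, ← Real.exp_mul]
  congr 1; push_cast; ring

lemma continuous_wt : Continuous wt := by unfold wt; fun_prop

lemma continuous_ker (a : ℂ) : Continuous (ker a) := by unfold ker; fun_prop

lemma measurable_wt : Measurable wt := continuous_wt.measurable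

lemma measurable_ker (a : ℂ) : Measurable (ker a) := (continuous_ker a).measurable

lemma differentiableOn_comp_moebius {H : ℂ → ℂ} (hH : DifferentiableOn ℂ H disk) {a : ℂ}
    (ha : a ∈ disk) : DifferentiableOn ℂ (fun w => H (moebius a w)) disk :=
  hH.comp (fun _ hz => (hasDerivAt_moebius ha hz).differentiableAt.differentiableWithinAt)
    fun _ hz => moebius_mem_disk ha hz

lemma exists_enorm_rpow_zero_le (p κ : ℝ) (hp : 0 < p) :
    ∃ C : ℝ≥0, ∀ H : ℂ → ℂ, DifferentiableOn ℂ H disk →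
      ‖H 0‖ₑ ^ p ≤ C * ∫⁻ z in disk, ‖H z‖ₑ ^ p * ENNReal.ofReal (wt z ^ κ) ∂areaMeasure := by
  have hpi := Real.pi_pos
  -- On |z| < 1/2 the weight lies in [3/4, 1], so (4/3)^{|κ|} compensates it for either sign of κ; 4
  -- is the ratio of the areas of the two disks.
  refine ⟨Real.toNNReal ((4 / 3) ^ |κ| * 4), fun H hH => ?_⟩
  have h1 := enorm_rpow_mul_le_lintegral_half_disk hp hH
  have hsub : Metric.ball (0 : ℂ) (1 / 2) ⊆ disk := Metric.ball_subset_ball (by norm_num)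
  have h2 : ∫⁻ z in Metric.ball (0 : ℂ) (1 / 2), ‖H z‖ₑ ^ p
      ≤ ENNReal.ofReal ((4 / 3) ^ |κ|) *
        ∫⁻ z in disk, ‖H z‖ₑ ^ p * ENNReal.ofReal (wt z ^ κ) := by
    rw [← lintegral_const_mul' _ _ ENNReal.ofReal_ne_top]
    refine le_trans ?_ (lintegral_mono_set hsub)
    refine setLIntegral_mono' Metric.isOpen_ball.measurableSet fun z hz => ?_
    rw [mul_left_comm, ← ENNReal.ofReal_mul (by positivity)]
    refine le_mul_of_one_le_right' ?_
    rw [ENNReal.one_le_ofReal]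
    have hz' : ‖z‖ < 1 / 2 := by simpa using hz
    have hw : 3 / 4 ≤ wt z := by unfold wt; nlinarith [norm_nonneg z]
    have hw1 := wt_le_one z
    have hw0 : 0 < wt z := by linarith
    calc (1 : ℝ) = (4 / 3) ^ |κ| * (3 / 4) ^ |κ| := by
          rw [← Real.mul_rpow (by norm_num) (by norm_num)]; norm_num
      _ ≤ (4 / 3) ^ |κ| * wt z ^ |κ| := by gcongr
      _ ≤ (4 / 3) ^ |κ| * wt z ^ κ := by
          gcongr 1
          exact Real.rpow_le_rpow_of_exponent_ge hw0 hw1 (le_abs_self κ)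
  have h3 := h1.trans h2
  rw [setLIntegral_areaMeasure, ← mul_assoc]
  set I := ∫⁻ z in disk, ‖H z‖ₑ ^ p * ENNReal.ofReal (wt z ^ κ)
  have e : ENNReal.ofReal ((4 / 3) ^ |κ| * 4) * (ENNReal.ofReal Real.pi)⁻¹
      = (ENNReal.ofReal (Real.pi / 4))⁻¹ * ENNReal.ofReal ((4 / 3) ^ |κ|) := by
    rw [← ENNReal.ofReal_inv_of_pos hpi, ← ENNReal.ofReal_inv_of_pos (by positivity),
      ← ENNReal.ofReal_mul (by positivity), ← ENNReal.ofReal_mul (by positivity)]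
    congr 1
    field_simp
  rw [show ((Real.toNNReal ((4 / 3) ^ |κ| * 4) : ℝ≥0) : ℝ≥0∞)
    = ENNReal.ofReal ((4 / 3) ^ |κ| * 4) from rfl, e, mul_assoc]
  calc ‖H 0‖ₑ ^ p = (ENNReal.ofReal (Real.pi / 4))⁻¹
        * (‖H 0‖ₑ ^ p * ENNReal.ofReal (Real.pi / 4)) := by
        rw [mul_left_comm, ENNReal.inv_mul_cancel (by simpa using hpi) ENNReal.ofReal_ne_top,
          mul_one]
    _ ≤ _ := by gcongr

/-- A weighted sub-mean value property of `|H|^p`, centred at an arbitrary point of the disk. -/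
lemma exists_enorm_rpow_le (p κ : ℝ) (hp : 0 < p) :
    ∃ C : ℝ≥0, ∀ H : ℂ → ℂ, DifferentiableOn ℂ H disk → ∀ u ∈ disk,
      ‖H u‖ₑ ^ p ≤ C * ∫⁻ z in disk, ‖H z‖ₑ ^ p *
        ENNReal.ofReal (wt u ^ (κ + 2) * wt z ^ κ * ker u z ^ (-2 * κ - 4)) ∂areaMeasure := by
  obtain ⟨C, hC⟩ := exists_enorm_rpow_zero_le p κ hp
  refine ⟨C, fun H hH u hu => ?_⟩
  -- The case of centre 0 is applied to H ∘ φ_u, and the integral is then transported back by φ_u.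
  have h := hC _ (differentiableOn_comp_moebius hH hu)
  rw [moebius_zero] at h
  refine h.trans (le_of_eq ?_)
  congr 1
  have h2 := lintegral_moebius hu
    (fun w => ‖H (moebius u w)‖ₑ ^ p * ENNReal.ofReal (wt w ^ κ))
  rw [h2]
  refine setLIntegral_congr_fun measurableSet_disk fun z hz => ?_
  have hx := wt_pos hu
  have hy := wt_pos hz
  have hk := ker_pos hu hz
  rw [moebius_moebius hu hz, wt_moebius hu hz, mul_assoc, ← ENNReal.ofReal_mul (by positivity),
    jac, jac_mul_rpow hx hy hk]

/-- Change of variables in `∫ |f|^p (1 - |z|^2)^γ |1 - conj a z|^{-c}`. -/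
lemma lintegral_rpow_ker_le_comp_moebius (f : ℂ → ℂ) {a : ℂ} (ha : a ∈ disk)
    (p : ℝ) {γ c : ℝ} (hc : 2 * γ + 4 ≤ c) :
    ∫⁻ z in disk, ‖f z‖ₑ ^ p * ENNReal.ofReal (wt z ^ γ * ker a z ^ (-c)) ∂areaMeasure
      ≤ ENNReal.ofReal (2 ^ (c - 2 * γ - 4) * wt a ^ (γ + 2 - c))
        * ∫⁻ w in disk, ‖f (moebius a w)‖ₑ ^ p * ENNReal.ofReal (wt w ^ γ) ∂areaMeasure := by
  rw [lintegral_moebius ha, ← lintegral_const_mul' _ _ ENNReal.ofReal_ne_top]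
  refine setLIntegral_mono' measurableSet_disk fun w hw => ?_
  have hx := wt_pos ha
  have hy := wt_pos hw
  have hk := ker_pos ha hw
  have hk2 := ker_le_two ha hw
  rw [mul_assoc, mul_left_comm (ENNReal.ofReal (2 ^ _ * _)), wt_moebius ha hw, ker_moebius ha hw,
    ← ENNReal.ofReal_mul (by positivity), ← ENNReal.ofReal_mul (by positivity), jac]
  refine mul_le_mul_right (ENNReal.ofReal_le_ofReal ?_) _
  -- After the substitution the kernel survives with exponent c - 2γ - 4 ≥ 0, so the bound `ker a w
  -- ≤ 2` is enough.
  have e : (wt a * wt w / ker a w ^ 2) ^ γ * (wt a / ker a w) ^ (-c) * (wt a / ker a w ^ 2) ^ 2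
      = ker a w ^ (c - 2 * γ - 4) * wt a ^ (γ + 2 - c) * wt w ^ γ := by
    obtain ⟨X, hX⟩ := exists_exp_eq hx
    obtain ⟨Y, hY⟩ := exists_exp_eq hy
    obtain ⟨K, hK⟩ := exists_exp_eq hk
    rw [hX, hY, hK]
    simp only [← Real.exp_nat_mul, ← Real.exp_add, ← Real.exp_sub, ← Real.exp_mul]
    congr 1; push_cast; ring
  rw [e]
  gcongr
  linarith

/-- A Forelli–Rudin estimate: the change of variables with f = 1. The range 2γ + 4 ≤ c is not sharp,
but it keeps the transformed kernel bounded. -/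
lemma exists_lintegral_ker_le (γ c : ℝ) (hγ : -1 < γ) (hc : 2 * γ + 4 ≤ c) :
    ∃ C : ℝ≥0, ∀ a ∈ disk,
      ∫⁻ z in disk, ENNReal.ofReal (wt z ^ γ * ker a z ^ (-c)) ∂areaMeasure
        ≤ C * ENNReal.ofReal (wt a ^ (γ + 2 - c)) := by
  have hfin := lintegral_wt_rpow_lt_top hγ
  set I := ∫⁻ z in disk, ENNReal.ofReal (wt z ^ γ) ∂areaMeasure with hI
  refine ⟨Real.toNNReal (2 ^ (c - 2 * γ - 4)) * I.toNNReal, fun a ha => ?_⟩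
  have h := lintegral_rpow_ker_le_comp_moebius (fun _ => 1) ha 1 hc
  simp only [enorm_one, ENNReal.one_rpow, one_mul] at h
  rwa [ENNReal.ofReal_mul (by positivity), mul_right_comm, ENNReal.ofReal, ← hI,
    ← ENNReal.coe_toNNReal hfin.ne, ← ENNReal.coe_mul] at h

/-! ### Growth of functions in F(p, pα - 2, s) -/

lemma fSeminorm_rpow {p : ℝ} (hp : 0 < p) (q s : ℝ) (f : ℂ → ℂ) :
    fSeminorm p q s f ^ p = ⨆ a ∈ disk, fIntegral p q s f a := by
  rw [fSeminorm, ← ENNReal.rpow_mul, one_div_mul_cancel hp.ne', ENNReal.rpow_one]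

lemma fIntegral_le_fSeminorm_rpow {p : ℝ} (hp : 0 < p) (q s : ℝ) (f : ℂ → ℂ) {a : ℂ}
    (ha : a ∈ disk) : fIntegral p q s f a ≤ fSeminorm p q s f ^ p := by
  rw [fSeminorm_rpow hp]
  exact le_iSup₂ (f := fun a (_ : a ∈ disk) => fIntegral p q s f a) a ha

/-- The weight on the right, divided by that on the left, is (2|1 - conj a z| / (1-|a|²))^{e-2s},
which is at least 1 since 1-|a|² ≤ 2|1 - conj a z|. -/
lemma lintegral_deriv_ker_le {p s e : ℝ} (hp : 0 < p) (α : ℝ) (he : 2 * s ≤ e) (f : ℂ → ℂ) {a : ℂ}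
    (ha : a ∈ disk) :
    ∫⁻ z in disk, ‖deriv f z‖ₑ ^ p *
        ENNReal.ofReal (wt z ^ (s + p * α - 2) * ker a z ^ (-e)) ∂areaMeasure
      ≤ ENNReal.ofReal (2 ^ (e - 2 * s) * wt a ^ (s - e))
        * fSeminorm p (p * α - 2) s f ^ p := by
  refine le_trans ?_ (mul_le_mul_right (fIntegral_le_fSeminorm_rpow hp _ _ f ha) _)
  rw [fIntegral, ← lintegral_const_mul' _ _ ENNReal.ofReal_ne_top]
  refine setLIntegral_mono' measurableSet_disk fun z hz => ?_
  have hx := wt_pos ha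
  have hy := wt_pos hz
  have hk := ker_pos ha hz
  have h2 := wt_le_two_ker ha hz
  rw [mul_left_comm, ← ENNReal.ofReal_mul (by positivity)]
  refine mul_le_mul_right (ENNReal.ofReal_le_ofReal ?_) _
  change _ ≤ _ * (wt z ^ (p * α - 2) * wt (moebius a z) ^ s)
  rw [wt_moebius ha hz]
  -- The base 2 is generalized to b so that it can be written as an exponential without affecting
  -- the 2s in the exponents.
  have e1 : ∀ b : ℝ, 0 < b → b ^ (e - 2 * s) * wt a ^ (s - e)
        * (wt z ^ (p * α - 2) * (wt a * wt z / ker a z ^ 2) ^ s)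
      = wt z ^ (s + p * α - 2) * ker a z ^ (-e) * (b * ker a z / wt a) ^ (e - 2 * s) := by
    intro b hb
    obtain ⟨X, hX⟩ := exists_exp_eq hx
    obtain ⟨Y, hY⟩ := exists_exp_eq hy
    obtain ⟨K, hK⟩ := exists_exp_eq hk
    obtain ⟨T, hT⟩ := exists_exp_eq hb
    rw [show ker a z ^ 2 = ker a z * ker a z by ring, hX, hY, hK, hT]
    simp only [← Real.exp_add, ← Real.exp_sub, ← Real.exp_mul]
    congr 1; ring
  rw [e1 2 two_pos]
  refine le_mul_of_one_le_right (by positivity) (Real.one_le_rpow ?_ (by linarith))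
  rwa [one_le_div hx]

/-- Functions in `F(p, pα - 2, s)` have the growth of the `α`-Bloch space. -/
lemma exists_enorm_deriv_rpow_le (p s α : ℝ) (hp : 0 < p) (hα : 0 < α) :
    ∃ C : ℝ≥0, ∀ f ∈ holo, ∀ u ∈ disk,
      ‖deriv f u‖ₑ ^ p
        ≤ C * ENNReal.ofReal (wt u ^ (-(p * α))) * fSeminorm p (p * α - 2) s f ^ p := by
  obtain ⟨C, hC⟩ := exists_enorm_rpow_le p (s + p * α - 2) hp
  refine ⟨C * Real.toNNReal (2 ^ (2 * (p * α))), fun f hf u hu => ?_⟩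
  refine (hC _ (DifferentiableOn.deriv hf isOpen_disk) u hu).trans ?_
  have hx := wt_pos hu
  rw [ENNReal.coe_mul, mul_assoc, mul_assoc]
  refine mul_le_mul_right ?_ _
  calc _ = ENNReal.ofReal (wt u ^ (s + p * α)) * ∫⁻ z in disk, ‖deriv f z‖ₑ ^ p *
        ENNReal.ofReal (wt z ^ (s + p * α - 2) * ker u z ^ (-(2 * (s + p * α)))) ∂areaMeasure := by
        rw [← lintegral_const_mul' _ _ ENNReal.ofReal_ne_top]
        refine setLIntegral_congr_fun measurableSet_disk fun z hz => ?_
        rw [mul_left_comm, ← ENNReal.ofReal_mul (by positivity), ← mul_assoc]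
        congr 4 <;> ring_nf
    _ ≤ _ := mul_le_mul_right (lintegral_deriv_ker_le hp α (by nlinarith) f hu) _
    _ = _ := by
        rw [← mul_assoc, ← mul_assoc, ← ENNReal.ofReal_mul (by positivity),
          show ((Real.toNNReal (2 ^ (2 * (p * α))) : ℝ≥0) : ℝ≥0∞)
            = ENNReal.ofReal (2 ^ (2 * (p * α))) from rfl, ← ENNReal.ofReal_mul (by positivity),
          mul_left_comm, ← Real.rpow_add hx]
        congr 4 <;> ring_nf

lemma exists_norm_deriv_le (p s α : ℝ) (hp : 0 < p) (hα : 0 < α) :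
    ∃ C : ℝ≥0, ∀ f ∈ fSpace p (p * α - 2) s, ∀ u ∈ disk,
      ‖deriv f u‖ ≤ C * (fSeminorm p (p * α - 2) s f).toReal * wt u ^ (-α) := by
  obtain ⟨C, hC⟩ := exists_enorm_deriv_rpow_le p s α hp hα
  refine ⟨C ^ (1 / p), fun f hf u hu => ?_⟩
  have h := hC f hf.1 u hu
  have hx := wt_pos hu
  set S := fSeminorm p (p * α - 2) s f
  have hS : S ≠ ∞ := hf.2.ne
  have hSp : S ^ p ≠ ∞ := ENNReal.rpow_ne_top_of_nonneg hp.le hS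
  have h2 := ENNReal.toReal_mono (by finiteness) h
  rw [ENNReal.toReal_mul, ENNReal.toReal_mul, ← ENNReal.toReal_rpow, ← ENNReal.toReal_rpow,
    ENNReal.toReal_ofReal (by positivity), toReal_enorm, ENNReal.coe_toReal] at h2
  have h3 := Real.rpow_le_rpow (by positivity) h2 (show 0 ≤ 1 / p by positivity)
  rw [← Real.rpow_mul (norm_nonneg _), mul_one_div_cancel hp.ne', Real.rpow_one,
    Real.mul_rpow (by positivity) (by positivity), Real.mul_rpow (by positivity) (by positivity),
    ← Real.rpow_mul hx.le, ← Real.rpow_mul (by positivity), mul_one_div_cancel hp.ne',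
    Real.rpow_one] at h3
  refine h3.trans (le_of_eq ?_)
  rw [NNReal.coe_rpow, show -(p * α) * (1 / p) = -α by field_simp]
  ring

/-- Along the segment t ↦ tz, the function ‖f(tz)‖ is compared with an explicit majorant whose
derivative dominates |z f'(tz)|, because 1 - t|z| ≤ 1 - |tz|². -/
lemma norm_le_of_norm_deriv_le {f : ℂ → ℂ} (hf : f ∈ holo) {α K : ℝ} (hα : 1 < α) (hK : 0 ≤ K)
    (h : ∀ u ∈ disk, ‖deriv f u‖ ≤ K * wt u ^ (-α)) {z : ℂ} (hz : z ∈ disk) :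
    ‖f z‖ ≤ ‖f 0‖ + K / (α - 1) * (1 - ‖z‖) ^ (1 - α) := by
  have hz' := mem_disk.1 hz
  have hmem : ∀ t ∈ Set.Icc (0 : ℝ) 1, (t : ℂ) * z ∈ disk := fun t ht => by
    rw [mem_disk, norm_mul, Complex.norm_real, Real.norm_of_nonneg ht.1]
    nlinarith [ht.1, ht.2, norm_nonneg z]
  have hpos : ∀ t ∈ Set.Icc (0 : ℝ) 1, 0 < 1 - t * ‖z‖ := fun t ht => by
    nlinarith [ht.1, ht.2, norm_nonneg z]
  have hd : ∀ t ∈ Set.Icc (0 : ℝ) 1,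
      HasDerivAt (fun t : ℝ => f (t * z)) (deriv f (t * z) * z) t := fun t ht => by
    have h1 : HasDerivAt f (deriv f (t * z)) (t * z) :=
      (hf.differentiableAt (isOpen_disk.mem_nhds (hmem t ht))).hasDerivAt
    have h2 : HasDerivAt (fun w : ℂ => w * z) z (t : ℂ) := by
      simpa using (hasDerivAt_id (t : ℂ)).mul_const z
    exact (h1.comp (t : ℂ) h2).comp_ofReal
  have hB : ∀ t ∈ Set.Icc (0 : ℝ) 1,
      HasDerivAt (fun t : ℝ => ‖f 0‖ + K / (α - 1) * (1 - t * ‖z‖) ^ (1 - α))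
        (K * ‖z‖ * (1 - t * ‖z‖) ^ (-α)) t := fun t ht => by
    have h1 : HasDerivAt (fun t : ℝ => 1 - t * ‖z‖) (-‖z‖) t := by
      simpa using ((hasDerivAt_id t).mul_const ‖z‖).const_sub 1
    have h2 := ((h1.rpow_const (p := 1 - α) (Or.inl (hpos t ht).ne')).const_mul
      (K / (α - 1))).const_add ‖f 0‖
    convert! h2 using 1
    have : α - 1 ≠ 0 := by linarith
    rw [show 1 - α - 1 = -α by ring]
    field_simp
    ring
  have := image_norm_le_of_norm_deriv_right_le_deriv_boundary'
    (f := fun t : ℝ => f (t * z)) (f' := fun t : ℝ => deriv f (t * z) * z) (a := 0) (b := 1)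
    (fun t ht => (hd t ht).continuousAt.continuousWithinAt)
    (fun t ht => (hd t (Set.Ico_subset_Icc_self ht)).hasDerivWithinAt)
    (B := fun t : ℝ => ‖f 0‖ + K / (α - 1) * (1 - t * ‖z‖) ^ (1 - α))
    (B' := fun t : ℝ => K * ‖z‖ * (1 - t * ‖z‖) ^ (-α))
    (by
      simp only [Complex.ofReal_zero, zero_mul, sub_zero, Real.one_rpow, mul_one]
      have : 0 ≤ K / (α - 1) := div_nonneg hK (by linarith)
      linarith)
    (fun t ht => (hB t ht).continuousAt.continuousWithinAt)
    (fun t ht => (hB t (Set.Ico_subset_Icc_self ht)).hasDerivWithinAt)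
    (fun t ht => by
      have ht' := Set.Ico_subset_Icc_self ht
      rw [norm_mul, mul_right_comm]
      refine mul_le_mul_of_nonneg_right ((h _ (hmem t ht')).trans ?_) (norm_nonneg z)
      refine mul_le_mul_of_nonneg_left ?_ hK
      refine Real.rpow_le_rpow_of_nonpos (hpos t ht') ?_ (by linarith)
      have := hpos t ht'
      have h0 : 0 ≤ t * ‖z‖ := mul_nonneg ht'.1 (norm_nonneg z)
      rw [wt, norm_mul, Complex.norm_real, Real.norm_of_nonneg ht'.1]
      nlinarith)
  simpa using this (Set.right_mem_Icc.2 zero_le_one)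

lemma fNorm_lt_top {p q s : ℝ} {f : ℂ → ℂ} (hf : f ∈ fSpace p q s) : fNorm p q s f < ∞ :=
  ENNReal.add_lt_top.2 ⟨enorm_lt_top, hf.2⟩

/-- Radial integration of the derivative bound gives (1-|z|)^{1-α}; as α > 1, the factor
(1-|z|²)^{1-α} is at least 1 and also absorbs |f(0)|. -/
lemma exists_enorm_rpow_le_fNorm (p s α : ℝ) (hp : 0 < p) (hα : 1 < α) :
    ∃ C : ℝ≥0, ∀ f ∈ fSpace p (p * α - 2) s, ∀ z ∈ disk,
      ‖f z‖ₑ ^ p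
        ≤ C * ENNReal.ofReal (wt z ^ (p - p * α)) * fNorm p (p * α - 2) s f ^ p := by
  obtain ⟨C, hC⟩ := exists_norm_deriv_le p s α hp (by linarith)
  set M : ℝ := 1 + C / (α - 1) * 2 ^ (α - 1) with hM
  have hα1 : 0 < α - 1 := by linarith
  have hMpos : 0 ≤ M := by positivity
  refine ⟨Real.toNNReal (M ^ p), fun f hf z hz => ?_⟩
  have hN := (fNorm_lt_top hf).ne
  set N := fNorm p (p * α - 2) s f with hNdef
  have hx := wt_pos hz
  have hz' := mem_disk.1 hz
  have hS : (fSeminorm p (p * α - 2) s f).toReal ≤ N.toReal :=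
    ENNReal.toReal_mono hN le_add_self
  have h0 : ‖f 0‖ ≤ N.toReal := by
    rw [← toReal_enorm]; exact ENNReal.toReal_mono hN le_self_add
  have h1 := norm_le_of_norm_deriv_le hf.1 hα (by positivity) (hC f hf) hz
  have h2 : (1 - ‖z‖) ^ (1 - α) ≤ 2 ^ (α - 1) * wt z ^ (1 - α) := by
    have h3 : wt z / 2 ≤ 1 - ‖z‖ := by
      unfold wt; nlinarith [norm_nonneg z]
    refine (Real.rpow_le_rpow_of_nonpos (by positivity) h3 (by linarith)).trans (le_of_eq ?_)
    rw [Real.div_rpow hx.le (by norm_num), show α - 1 = -(1 - α) by ring,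
      Real.rpow_neg (by norm_num), div_eq_inv_mul]
  have h4 : 1 ≤ wt z ^ (1 - α) :=
    Real.one_le_rpow_of_pos_of_le_one_of_nonpos hx (wt_le_one z) (by linarith)
  have h5 : ‖f z‖ ≤ M * wt z ^ (1 - α) * N.toReal := by
    calc ‖f z‖ ≤ ‖f 0‖ + C * (fSeminorm p (p * α - 2) s f).toReal / (α - 1)
          * (1 - ‖z‖) ^ (1 - α) := h1
      _ ≤ N.toReal * wt z ^ (1 - α) + C * N.toReal / (α - 1)
          * (2 ^ (α - 1) * wt z ^ (1 - α)) := by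
          have h6 : N.toReal ≤ N.toReal * wt z ^ (1 - α) :=
            le_mul_of_one_le_right ENNReal.toReal_nonneg h4
          have h7 := Real.rpow_nonneg (show 0 ≤ 1 - ‖z‖ by linarith) (1 - α)
          gcongr
          exact h0.trans h6
      _ = _ := by rw [hM]; ring
  rw [show ((Real.toNNReal (M ^ p) : ℝ≥0) : ℝ≥0∞) = ENNReal.ofReal (M ^ p) from rfl,
    ← ENNReal.ofReal_toReal hN, ENNReal.ofReal_rpow_of_nonneg ENNReal.toReal_nonneg hp.le,
    ← ENNReal.ofReal_mul (by positivity), ← ENNReal.ofReal_mul (by positivity),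
    enorm_rpow_eq_ofReal hp.le]
  refine ENNReal.ofReal_le_ofReal ((Real.rpow_le_rpow (norm_nonneg _) h5 hp.le).trans
    (le_of_eq ?_))
  rw [Real.mul_rpow (by positivity) ENNReal.toReal_nonneg, Real.mul_rpow hMpos (by positivity),
    ← Real.rpow_mul hx.le]
  congr 3
  ring

/-! ### Estimating g - g(0) by a kernel integral of g' -/

lemma continuous_ker_uncurry : Continuous fun q : ℂ × ℂ => ker q.1 q.2 := by
  unfold ker
  have : Continuous fun q : ℂ × ℂ => (starRingEnd ℂ) q.1 :=
    Complex.continuous_conj.comp continuous_fst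
  fun_prop

lemma real_smul_mem_disk {w : ℂ} (hw : w ∈ disk) {t : ℝ} (ht : t ∈ Set.Icc (0 : ℝ) 1) :
    (t : ℂ) * w ∈ disk := by
  rw [mem_disk] at hw ⊢
  rw [norm_mul, Complex.norm_real, Real.norm_of_nonneg ht.1]
  nlinarith [ht.1, ht.2, norm_nonneg w]

lemma enorm_sub_le_lintegral_deriv {g : ℂ → ℂ} (hg : g ∈ holo) {w : ℂ} (hw : w ∈ disk) :
    ‖g w - g 0‖ₑ ≤ ∫⁻ t in Set.Ioc (0 : ℝ) 1, ‖deriv g (t * w)‖ₑ := by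
  have hd : ∀ t ∈ Set.uIcc (0 : ℝ) 1,
      HasDerivAt (fun t : ℝ => g (t * w)) (deriv g (t * w) * w) t := fun t ht => by
    rw [Set.uIcc_of_le zero_le_one] at ht
    have h1 : HasDerivAt g (deriv g (t * w)) (t * w) :=
      (hg.differentiableAt (isOpen_disk.mem_nhds (real_smul_mem_disk hw ht))).hasDerivAt
    have h2 : HasDerivAt (fun v : ℂ => v * w) w (t : ℂ) := by
      simpa using (hasDerivAt_id (t : ℂ)).mul_const w
    exact (h1.comp (t : ℂ) h2).comp_ofReal
  have hc : ContinuousOn (fun t : ℝ => deriv g (t * w) * w) (Set.uIcc 0 1) := by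
    refine ContinuousOn.mul ?_ continuousOn_const
    refine (DifferentiableOn.deriv hg isOpen_disk).continuousOn.comp (by fun_prop) fun t ht => ?_
    rw [Set.uIcc_of_le zero_le_one] at ht
    exact real_smul_mem_disk hw ht
  have h := intervalIntegral.integral_eq_sub_of_hasDerivAt hd hc.intervalIntegrable
  simp only [Complex.ofReal_one, one_mul, Complex.ofReal_zero, zero_mul] at h
  rw [← h, intervalIntegral.integral_of_le zero_le_one]
  refine (enorm_integral_le_lintegral_enorm _).trans (lintegral_mono fun t => ?_)
  rw [enorm_mul]
  refine mul_le_of_le_one_right' ?_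
  rw [← ofReal_norm, ENNReal.ofReal_le_one]
  exact (mem_disk.1 hw).le

/-- Both 1 - t and ker(w,v) - ker(tw,v) are at most ker(tw,v): the second is at most (1 - t)|w||v|.
-/
lemma ker_add_one_sub_le {w v : ℂ} (hw : w ∈ disk) (hv : v ∈ disk) {t : ℝ}
    (ht : t ∈ Set.Icc (0 : ℝ) 1) : ker w v + (1 - t) ≤ 3 * ker (t * w) v := by
  rw [mem_disk] at hw hv
  have h1 := one_sub_norm_mul_le_ker (t * w) v
  rw [norm_mul, Complex.norm_real, Real.norm_of_nonneg ht.1] at h1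
  have hwv : ‖w‖ * ‖v‖ ≤ 1 := by nlinarith [norm_nonneg w, norm_nonneg v]
  have h2 : 1 - t ≤ ker (t * w) v := by nlinarith [ht.1]
  have h3 : ker w v ≤ ker (t * w) v + (1 - t) * (‖w‖ * ‖v‖) := by
    unfold ker
    have e : 1 - (starRingEnd ℂ) w * v = (1 - (starRingEnd ℂ) (t * w) * v)
        - ((1 - t : ℝ) : ℂ) * ((starRingEnd ℂ) w * v) := by
      simp; ring
    rw [e]
    refine (norm_sub_le _ _).trans (le_of_eq ?_)
    rw [norm_mul (((1 - t : ℝ) : ℂ)), Complex.norm_real, Real.norm_of_nonneg (by linarith [ht.2]),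
      norm_mul ((starRingEnd ℂ) w), Complex.norm_conj]
  nlinarith [ht.2]

lemma lintegral_add_one_sub_rpow_le {d m : ℝ} (hd : 0 < d) (hm : 0 < m) :
    ∫⁻ t in Set.Ioc (0 : ℝ) 1, ENNReal.ofReal ((d + (1 - t)) ^ (-m - 1))
      ≤ ENNReal.ofReal (m⁻¹ * d ^ (-m)) := by
  have hpos : ∀ t ∈ Set.uIcc (0 : ℝ) 1, 0 < d + (1 - t) := fun t ht => by
    rw [Set.uIcc_of_le zero_le_one] at ht
    linarith [ht.2]
  have hder : ∀ t ∈ Set.uIcc (0 : ℝ) 1, HasDerivAt (fun t : ℝ => m⁻¹ * (d + (1 - t)) ^ (-m))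
      ((d + (1 - t)) ^ (-m - 1)) t := fun t ht => by
    have h1 : HasDerivAt (fun t : ℝ => d + (1 - t)) (-1) t :=
      ((hasDerivAt_id t).const_sub 1).const_add d
    convert! (h1.rpow_const (p := -m) (Or.inl (hpos t ht).ne')).const_mul m⁻¹ using 1
    field_simp
  have hc : ContinuousOn (fun t : ℝ => (d + (1 - t)) ^ (-m - 1)) (Set.uIcc 0 1) :=
    ContinuousOn.rpow_const (by fun_prop) fun t ht => Or.inl (hpos t ht).ne'
  have h := intervalIntegral.integral_eq_sub_of_hasDerivAt hder hc.intervalIntegrable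
  rw [intervalIntegral.integral_of_le zero_le_one] at h
  rw [← ofReal_integral_eq_lintegral_ofReal, h]
  · refine ENNReal.ofReal_le_ofReal ?_
    have : 0 ≤ m⁻¹ * (d + (1 - 0)) ^ (-m) := by positivity
    simp only [sub_self, add_zero]
    linarith
  · exact hc.intervalIntegrable.1
  · filter_upwards [ae_restrict_mem measurableSet_Ioc] with t ht
    exact Real.rpow_nonneg (by linarith [ht.2]) _

lemma mul_rpow_mul_rpow_neg {b c k : ℝ} (hb : 0 < b) (hc : 0 < c) (hk : 0 < k) (m : ℝ) :
    (b * k) ^ (m - 1 + 2) * k ^ (-2 * (m - 1) - 4) = (b * c) ^ (m + 1) * (c * k) ^ (-m - 1) := by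
  obtain ⟨B, rfl⟩ := exists_exp_eq hb
  obtain ⟨X, rfl⟩ := exists_exp_eq hc
  obtain ⟨K, rfl⟩ := exists_exp_eq hk
  simp only [← Real.exp_add, ← Real.exp_mul]
  congr 1; ring

lemma rpow_mul_div_rpow_neg {b x : ℝ} (hb : 0 < b) (hx : 0 < x) (κ : ℝ) :
    x ^ (κ + 2) * (x / b) ^ (-2 * κ - 4) = b ^ (2 * κ + 4) * x ^ (-(κ + 2)) := by
  obtain ⟨B, rfl⟩ := exists_exp_eq hb
  obtain ⟨X, rfl⟩ := exists_exp_eq hx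
  simp only [← Real.exp_add, ← Real.exp_sub, ← Real.exp_mul]
  congr 1; ring

/-- A reproducing-kernel type estimate for `g - g 0` in terms of the derivative of `g`. -/
lemma exists_enorm_sub_le (m : ℝ) (hm : 0 < m) :
    ∃ C : ℝ≥0, ∀ g ∈ holo, ∀ w ∈ disk,
      ‖g w - g 0‖ₑ ≤ C * ∫⁻ v in disk, ‖deriv g v‖ₑ *
        ENNReal.ofReal (wt v ^ (m - 1) * ker w v ^ (-m)) ∂areaMeasure := by
  obtain ⟨C, hC⟩ := exists_enorm_rpow_le 1 (m - 1) one_pos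
  refine ⟨C * Real.toNNReal (6 ^ (m + 1) * m⁻¹), fun g hg w hw => ?_⟩
  have hdg := DifferentiableOn.deriv hg isOpen_disk
  calc ‖g w - g 0‖ₑ ≤ ∫⁻ t in Set.Ioc (0 : ℝ) 1, ‖deriv g (t * w)‖ₑ :=
        enorm_sub_le_lintegral_deriv hg hw
    _ ≤ ∫⁻ t in Set.Ioc (0 : ℝ) 1, C * (∫⁻ v in disk, ‖deriv g v‖ₑ * ENNReal.ofReal
          (6 ^ (m + 1) * (wt v ^ (m - 1) * (ker w v + (1 - t)) ^ (-m - 1))) ∂areaMeasure) := by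
        refine setLIntegral_mono' measurableSet_Ioc fun t ht => ?_
        have ht' := Set.Ioc_subset_Icc_self ht
        have hu := real_smul_mem_disk hw ht'
        have h := hC _ hdg _ hu
        simp only [ENNReal.rpow_one] at h
        refine h.trans (mul_le_mul_right (setLIntegral_mono' measurableSet_disk fun v hv => ?_) _)
        refine mul_le_mul_right (ENNReal.ofReal_le_ofReal ?_) _
        have hx := wt_pos hu
        have hy := wt_pos hv
        have hk := ker_pos hu hv
        have hk2 := ker_pos hw hv
        have h1 := wt_le_two_ker hu hv
        have h2 := ker_add_one_sub_le hw hv ht'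
        have hpos : 0 < ker w v + (1 - t) := by linarith [ht'.2]
        set k := ker (t * w) v
        -- The bound 1-|tw|² ≤ 2k leaves 2^{m+1} k^{-m-1}, and 3k ≥ `ker w v + (1 - t)` contributes
        -- 3^{m+1}; hence 6^{m+1}. The power -m-1 integrates in t to the kernel power -m.
        calc wt ((t : ℂ) * w) ^ (m - 1 + 2) * wt v ^ (m - 1) * k ^ (-2 * (m - 1) - 4)
            ≤ (2 * k) ^ (m - 1 + 2) * wt v ^ (m - 1) * k ^ (-2 * (m - 1) - 4) := by
              gcongr; linarith
          _ = 6 ^ (m + 1) * (wt v ^ (m - 1) * (3 * k) ^ (-m - 1)) := by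
              rw [show (6 : ℝ) = 2 * 3 by norm_num, mul_right_comm,
                mul_rpow_mul_rpow_neg two_pos three_pos hk]
              ring
          _ ≤ _ := by
              have := Real.rpow_le_rpow_of_nonpos hpos h2 (show -m - 1 ≤ 0 by linarith)
              gcongr
    _ = C * ∫⁻ v in disk, (∫⁻ t in Set.Ioc (0 : ℝ) 1, ‖deriv g v‖ₑ * ENNReal.ofReal
          (6 ^ (m + 1) * (wt v ^ (m - 1) * (ker w v + (1 - t)) ^ (-m - 1)))) ∂areaMeasure := by
        rw [lintegral_const_mul' _ _ ENNReal.coe_ne_top, lintegral_lintegral_swap]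
        refine Measurable.aemeasurable ?_
        have h1 : Measurable fun q : ℝ × ℂ => deriv g q.2 :=
          (measurable_deriv g).comp measurable_snd
        have h2 : Measurable fun q : ℝ × ℂ => wt q.2 := measurable_wt.comp measurable_snd
        have h3 : Measurable fun q : ℝ × ℂ => ker w q.2 :=
          (measurable_ker w).comp measurable_snd
        simp only [Function.uncurry_def]
        fun_prop
    _ ≤ C * ∫⁻ v in disk, ‖deriv g v‖ₑ * ENNReal.ofReal
          (6 ^ (m + 1) * m⁻¹ * (wt v ^ (m - 1) * ker w v ^ (-m))) ∂areaMeasure := by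
        refine mul_le_mul_right (setLIntegral_mono' measurableSet_disk fun v hv => ?_) _
        have hy := wt_pos hv
        have hk := ker_pos hw hv
        rw [lintegral_const_mul' _ _ enorm_ne_top]
        refine mul_le_mul_right ?_ _
        have e : ∀ t : ℝ, ENNReal.ofReal
            (6 ^ (m + 1) * (wt v ^ (m - 1) * (ker w v + (1 - t)) ^ (-m - 1)))
            = ENNReal.ofReal (6 ^ (m + 1) * wt v ^ (m - 1))
              * ENNReal.ofReal ((ker w v + (1 - t)) ^ (-m - 1)) := fun t => by
          rw [← ENNReal.ofReal_mul (by positivity), mul_assoc]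
        simp_rw [e]
        rw [lintegral_const_mul' _ _ ENNReal.ofReal_ne_top]
        refine (mul_le_mul_right (lintegral_add_one_sub_rpow_le hk hm) _).trans (le_of_eq ?_)
        rw [← ENNReal.ofReal_mul (by positivity)]
        congr 1; ring
    _ = _ := by
        rw [ENNReal.coe_mul, mul_assoc, show ((Real.toNNReal (6 ^ (m + 1) * m⁻¹) : ℝ≥0) : ℝ≥0∞)
          = ENNReal.ofReal (6 ^ (m + 1) * m⁻¹) from rfl,
          ← lintegral_const_mul' _ _ ENNReal.ofReal_ne_top]
        congr 1
        refine lintegral_congr fun v => ?_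
        rw [ENNReal.ofReal_mul (by positivity), mul_left_comm]

/-! ### Hardy–Littlewood inequality for p ≤ 1 -/

/-- For `p ≤ 1` a weighted Bergman space of exponent `p` embeds into one of exponent `1`. -/
lemma exists_lintegral_enorm_le (p κ : ℝ) (hp : 0 < p) (hp1 : p ≤ 1) (hκ : -2 ≤ κ) :
    ∃ C : ℝ≥0, ∀ h : ℂ → ℂ, DifferentiableOn ℂ h disk →
      ∫⁻ z in disk, ‖h z‖ₑ * ENNReal.ofReal (wt z ^ ((κ + 2) / p - 2)) ∂areaMeasure
        ≤ C * (∫⁻ z in disk, ‖h z‖ₑ ^ p * ENNReal.ofReal (wt z ^ κ) ∂areaMeasure) ^ (1 / p) := by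
  obtain ⟨C, hC⟩ := exists_enorm_rpow_le p κ hp
  set β := (1 - p) / p with hβ
  have hβ0 : 0 ≤ β := div_nonneg (by linarith) hp.le
  refine ⟨(C * Real.toNNReal (2 ^ (2 * κ + 4))) ^ β, fun h hh => ?_⟩
  set Y := ∫⁻ z in disk, ‖h z‖ₑ ^ p * ENNReal.ofReal (wt z ^ κ) ∂areaMeasure with hY
  -- Since κ ≥ -2, the kernel power in the sub-mean value inequality is nonpositive and may be
  -- bounded using `wt u / 2 ≤ ker u z`, which yields Bergman-space growth.
  have hpt : ∀ u ∈ disk, ‖h u‖ₑ ^ p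
      ≤ (C * Real.toNNReal (2 ^ (2 * κ + 4)) : ℝ≥0) * ENNReal.ofReal (wt u ^ (-(κ + 2))) * Y := by
    intro u hu
    refine (hC h hh u hu).trans ?_
    have hx := wt_pos hu
    rw [ENNReal.coe_mul, mul_assoc, mul_assoc]
    refine mul_le_mul_right ?_ _
    rw [show ((Real.toNNReal (2 ^ (2 * κ + 4)) : ℝ≥0) : ℝ≥0∞)
      = ENNReal.ofReal (2 ^ (2 * κ + 4)) from rfl, ← mul_assoc,
      ← ENNReal.ofReal_mul (by positivity), hY, ← lintegral_const_mul' _ _ ENNReal.ofReal_ne_top]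
    refine setLIntegral_mono' measurableSet_disk fun z hz => ?_
    have hy := wt_pos hz
    have hk := ker_pos hu hz
    have h1 := wt_le_two_ker hu hz
    rw [mul_left_comm, ← ENNReal.ofReal_mul (by positivity)]
    refine mul_le_mul_right (ENNReal.ofReal_le_ofReal ?_) _
    have h2 := Real.rpow_le_rpow_of_nonpos (x := wt u / 2) (y := ker u z) (by positivity)
      (by linarith) (show -2 * κ - 4 ≤ 0 by linarith)
    calc wt u ^ (κ + 2) * wt z ^ κ * ker u z ^ (-2 * κ - 4)
        ≤ wt u ^ (κ + 2) * wt z ^ κ * (wt u / 2) ^ (-2 * κ - 4) := by gcongr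
      _ = _ := by
          rw [mul_right_comm, rpow_mul_div_rpow_neg two_pos hx]
  set C' : ℝ≥0 := C * Real.toNNReal (2 ^ (2 * κ + 4)) with hC'
  have hm : AEMeasurable (fun z => ‖h z‖ₑ ^ p * ENNReal.ofReal (wt z ^ κ))
      (areaMeasure.restrict disk) := by
    have := hh.continuousOn.aemeasurable (μ := areaMeasure) measurableSet_disk
    have := measurable_wt
    fun_prop
  calc ∫⁻ z in disk, ‖h z‖ₑ * ENNReal.ofReal (wt z ^ ((κ + 2) / p - 2)) ∂areaMeasure
      ≤ ∫⁻ z in disk, ((C' : ℝ≥0∞) ^ β * Y ^ β) *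
        (‖h z‖ₑ ^ p * ENNReal.ofReal (wt z ^ κ)) ∂areaMeasure := by
        refine setLIntegral_mono' measurableSet_disk fun z hz => ?_
        have hx := wt_pos hz
        -- One power p is kept for the integral and the remaining 1 - p = pβ ≥ 0 is bounded
        -- pointwise by `hpt`.
        have e1 : ‖h z‖ₑ = ‖h z‖ₑ ^ p * (‖h z‖ₑ ^ p) ^ β := by
          rw [← ENNReal.rpow_mul, ← ENNReal.rpow_add_of_nonneg _ _ hp.le (by positivity),
            show p + p * β = 1 by rw [hβ]; field_simp; ring, ENNReal.rpow_one]
        have e2 := ENNReal.rpow_le_rpow (hpt z hz) hβ0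
        rw [ENNReal.mul_rpow_of_nonneg _ _ hβ0, ENNReal.mul_rpow_of_nonneg _ _ hβ0,
          ENNReal.ofReal_rpow_of_nonneg (by positivity) hβ0, ← Real.rpow_mul hx.le] at e2
        calc ‖h z‖ₑ * ENNReal.ofReal (wt z ^ ((κ + 2) / p - 2))
            = ‖h z‖ₑ ^ p * (‖h z‖ₑ ^ p) ^ β * ENNReal.ofReal (wt z ^ ((κ + 2) / p - 2)) := by
              rw [← e1]
          _ ≤ ‖h z‖ₑ ^ p * ((C' : ℝ≥0∞) ^ β * ENNReal.ofReal (wt z ^ (-(κ + 2) * β)) * Y ^ β)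
              * ENNReal.ofReal (wt z ^ ((κ + 2) / p - 2)) := by gcongr
          _ = ((C' : ℝ≥0∞) ^ β * Y ^ β) * (‖h z‖ₑ ^ p * (ENNReal.ofReal (wt z ^ (-(κ + 2) * β))
              * ENNReal.ofReal (wt z ^ ((κ + 2) / p - 2)))) := by ring
          _ = _ := by
              rw [← ENNReal.ofReal_mul (by positivity), ← Real.rpow_add hx,
                show -(κ + 2) * β + ((κ + 2) / p - 2) = κ by rw [hβ]; field_simp; ring]
    _ = (C' : ℝ≥0∞) ^ β * (Y ^ β * Y) := by
        rw [lintegral_const_mul'' _ hm, mul_assoc]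
    _ = _ := by
        rw [ENNReal.coe_rpow_of_nonneg _ hβ0]
        congr 1
        nth_rw 2 [← ENNReal.rpow_one Y]
        rw [← ENNReal.rpow_add_of_nonneg _ _ hβ0 zero_le_one]
        congr 1
        rw [hβ]; field_simp; ring

lemma differentiableOn_div_pow {f : ℂ → ℂ} (hf : DifferentiableOn ℂ f disk) {a : ℂ}
    (ha : a ∈ disk) (n : ℕ) :
    DifferentiableOn ℂ (fun z => f z / (1 - (starRingEnd ℂ) a * z) ^ n) disk :=
  hf.div (by fun_prop) fun z hz => pow_ne_zero _ (one_sub_conj_mul_ne_zero ha hz)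

lemma enorm_div_pow (f : ℂ → ℂ) {a z : ℂ} (ha : a ∈ disk) (hz : z ∈ disk) (n : ℕ) :
    ‖f z / (1 - (starRingEnd ℂ) a * z) ^ n‖ₑ
      = ‖f z‖ₑ * ENNReal.ofReal (ker a z ^ (-(n : ℝ))) := by
  have hk := ker_pos ha hz
  rw [← ofReal_norm, norm_div, norm_pow, Real.rpow_neg hk.le, Real.rpow_natCast, div_eq_mul_inv,
    ENNReal.ofReal_mul (norm_nonneg _), ofReal_norm]
  rfl

lemma enorm_div_pow_rpow (f : ℂ → ℂ) {a z : ℂ} (ha : a ∈ disk) (hz : z ∈ disk) (n : ℕ)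
    {p : ℝ} (hp : 0 ≤ p) :
    ‖f z / (1 - (starRingEnd ℂ) a * z) ^ n‖ₑ ^ p
      = ‖f z‖ₑ ^ p * ENNReal.ofReal (ker a z ^ (-(n * p))) := by
  have hk := ker_pos ha hz
  rw [enorm_div_pow f ha hz, ENNReal.mul_rpow_of_nonneg _ _ hp,
    ENNReal.ofReal_rpow_of_nonneg (by positivity) hp, ← Real.rpow_mul hk.le, neg_mul]

/-- The embedding into exponent 1 is applied to v ↦ g'(v)/(1 - conj w v)^m, which puts the power p
inside the kernel integral; a natural m makes the denominator a polynomial. The weight is chosen so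
that (κ+2)/p - 2 = m - 1. -/
lemma exists_enorm_sub_rpow_le (p : ℝ) (m : ℕ) (hp : 0 < p) (hp1 : p ≤ 1) (hm : 0 < m) :
    ∃ C : ℝ≥0, ∀ g ∈ holo, ∀ w ∈ disk,
      ‖g w - g 0‖ₑ ^ p ≤ C * ∫⁻ v in disk, ‖deriv g v‖ₑ ^ p *
        ENNReal.ofReal (wt v ^ (p * (m + 1) - 2) * ker w v ^ (-(m * p))) ∂areaMeasure := by
  obtain ⟨C₁, hC₁⟩ := exists_enorm_sub_le m (by exact_mod_cast hm)
  obtain ⟨C₂, hC₂⟩ := exists_lintegral_enorm_le p (p * (m + 1) - 2) hp hp1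
    (by have : 0 ≤ p * (m + 1) := by positivity
        linarith)
  refine ⟨(C₁ * C₂) ^ p, fun g hg w hw => ?_⟩
  have h2 := hC₂ _ (differentiableOn_div_pow (DifferentiableOn.deriv hg isOpen_disk) hw m)
  have e1 : ∀ v ∈ disk, ‖deriv g v / (1 - (starRingEnd ℂ) w * v) ^ m‖ₑ
      * ENNReal.ofReal (wt v ^ ((p * (m + 1) - 2 + 2) / p - 2))
      = ‖deriv g v‖ₑ * ENNReal.ofReal (wt v ^ ((m : ℝ) - 1) * ker w v ^ (-(m : ℝ))) := by
    intro v hv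
    have hk := ker_pos hw hv
    rw [enorm_div_pow (deriv g) hw hv, mul_assoc, ← ENNReal.ofReal_mul (by positivity),
      mul_comm (ker w v ^ _),
      show (p * (m + 1) - 2 + 2) / p - 2 = (m : ℝ) - 1 by field_simp; ring]
  have e2 : ∀ v ∈ disk, ‖deriv g v / (1 - (starRingEnd ℂ) w * v) ^ m‖ₑ ^ p
      * ENNReal.ofReal (wt v ^ (p * (m + 1) - 2))
      = ‖deriv g v‖ₑ ^ p
        * ENNReal.ofReal (wt v ^ (p * (m + 1) - 2) * ker w v ^ (-(m * p))) := by
    intro v hv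
    have hk := ker_pos hw hv
    rw [enorm_div_pow_rpow (deriv g) hw hv m hp.le, mul_assoc, ← ENNReal.ofReal_mul (by positivity),
      mul_comm (ker w v ^ _)]
  rw [setLIntegral_congr_fun measurableSet_disk e1,
    setLIntegral_congr_fun measurableSet_disk e2] at h2
  have h := ENNReal.rpow_le_rpow ((hC₁ g hg w hw).trans (mul_le_mul_right h2 _)) hp.le
  refine h.trans (le_of_eq ?_)
  rw [← mul_assoc, ENNReal.mul_rpow_of_nonneg _ _ hp.le, ← ENNReal.rpow_mul,
    one_div_mul_cancel hp.ne', ENNReal.rpow_one, ← ENNReal.coe_mul,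
    ENNReal.coe_rpow_of_nonneg _ hp.le]

/-- The Hardy–Littlewood inequality for `p ≤ 1`. -/
lemma exists_lintegral_rpow_le (p γ : ℝ) (hp : 0 < p) (hp1 : p ≤ 1) (hγ : -1 < γ) :
    ∃ C : ℝ≥0, ∀ g ∈ holo,
      ∫⁻ z in disk, ‖g z‖ₑ ^ p * ENNReal.ofReal (wt z ^ γ) ∂areaMeasure
        ≤ C * (‖g 0‖ₑ ^ p
          + ∫⁻ z in disk, ‖deriv g z‖ₑ ^ p * ENNReal.ofReal (wt z ^ (γ + p)) ∂areaMeasure) := by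
  -- This m gives mp > 2γ + 4, so that after Tonelli the inner integral in w is a Forelli–Rudin
  -- integral; the exponents then add up to γ + p.
  obtain ⟨m, hm⟩ := exists_nat_gt ((2 * γ + 4) / p)
  have hm0 : 0 < m := by
    have : (0 : ℝ) < m := lt_trans (div_pos (by linarith) hp) hm
    exact_mod_cast this
  rw [div_lt_iff₀ hp] at hm
  obtain ⟨C₁, hC₁⟩ := exists_enorm_sub_rpow_le p m hp hp1 hm0
  obtain ⟨C₂, hC₂⟩ := exists_lintegral_ker_le γ (m * p) hγ hm.le
  have hfin := lintegral_wt_rpow_lt_top hγ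
  set W := ∫⁻ z in disk, ENNReal.ofReal (wt z ^ γ) ∂areaMeasure with hW
  refine ⟨W.toNNReal + C₁ * C₂, fun g hg => ?_⟩
  set I := ∫⁻ z in disk, ‖deriv g z‖ₑ ^ p * ENNReal.ofReal (wt z ^ (γ + p)) ∂areaMeasure with hI
  have hmw := measurable_wt
  have hmd := measurable_deriv g
  have key : ∫⁻ z in disk, ‖g z - g 0‖ₑ ^ p * ENNReal.ofReal (wt z ^ γ) ∂areaMeasure
      ≤ C₁ * C₂ * I := by
    calc _ ≤ ∫⁻ w in disk, C₁ * (∫⁻ v in disk, ‖deriv g v‖ₑ ^ p *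
          ENNReal.ofReal (wt v ^ (p * (m + 1) - 2) * ker w v ^ (-(m * p)))
            * ENNReal.ofReal (wt w ^ γ) ∂areaMeasure) ∂areaMeasure := by
          refine setLIntegral_mono' measurableSet_disk fun w hw => ?_
          rw [lintegral_mul_const' _ _ ENNReal.ofReal_ne_top, ← mul_assoc]
          gcongr
          exact hC₁ g hg w hw
      _ = C₁ * ∫⁻ v in disk, (∫⁻ w in disk, ‖deriv g v‖ₑ ^ p *
          ENNReal.ofReal (wt v ^ (p * (m + 1) - 2) * ker w v ^ (-(m * p)))
            * ENNReal.ofReal (wt w ^ γ) ∂areaMeasure) ∂areaMeasure := by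
          rw [lintegral_const_mul' _ _ ENNReal.coe_ne_top, lintegral_lintegral_swap]
          refine Measurable.aemeasurable ?_
          have h1 : Measurable fun q : ℂ × ℂ => deriv g q.2 := hmd.comp measurable_snd
          have h2 : Measurable fun q : ℂ × ℂ => wt q.2 := hmw.comp measurable_snd
          have h3 : Measurable fun q : ℂ × ℂ => wt q.1 := hmw.comp measurable_fst
          have h4 := continuous_ker_uncurry.measurable
          simp only [Function.uncurry_def]
          fun_prop
      _ ≤ C₁ * ∫⁻ v in disk, C₂ * (‖deriv g v‖ₑ ^ p * ENNReal.ofReal (wt v ^ (γ + p)))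
            ∂areaMeasure := by
          refine mul_le_mul_right (setLIntegral_mono' measurableSet_disk fun v hv => ?_) _
          have hy := wt_pos hv
          calc _ = ‖deriv g v‖ₑ ^ p * ENNReal.ofReal (wt v ^ (p * (m + 1) - 2))
                * ∫⁻ w in disk, ENNReal.ofReal (wt w ^ γ * ker v w ^ (-(m * p)))
                  ∂areaMeasure := by
                rw [← lintegral_const_mul' _ _ (by finiteness)]
                refine setLIntegral_congr_fun measurableSet_disk fun w hw => ?_
                have hk := ker_pos hv hw
                have hx := wt_pos hw
                rw [ker_comm w v, mul_assoc, mul_assoc, ← ENNReal.ofReal_mul (by positivity),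
                  ← ENNReal.ofReal_mul (by positivity)]
                congr 2; ring
            _ ≤ ‖deriv g v‖ₑ ^ p * ENNReal.ofReal (wt v ^ (p * (m + 1) - 2))
                * (C₂ * ENNReal.ofReal (wt v ^ (γ + 2 - m * p))) := by
                gcongr
                exact hC₂ v hv
            _ = C₂ * (‖deriv g v‖ₑ ^ p * (ENNReal.ofReal (wt v ^ (p * (m + 1) - 2))
                * ENNReal.ofReal (wt v ^ (γ + 2 - m * p)))) := by ring
            _ = _ := by
                rw [← ENNReal.ofReal_mul (by positivity), ← Real.rpow_add hy]
                congr 4; ring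
      _ = _ := by
          rw [lintegral_const_mul' _ _ ENNReal.coe_ne_top, mul_assoc]
  calc _ ≤ ∫⁻ z in disk, (‖g 0‖ₑ ^ p * ENNReal.ofReal (wt z ^ γ)
        + ‖g z - g 0‖ₑ ^ p * ENNReal.ofReal (wt z ^ γ)) ∂areaMeasure := by
        refine lintegral_mono fun z => ?_
        rw [← add_mul]
        gcongr
        refine le_trans ?_ (ENNReal.rpow_add_le_add_rpow _ _ hp.le hp1)
        refine ENNReal.rpow_le_rpow ?_ hp.le
        simpa using enorm_add_le (g 0) (g z - g 0)
    _ = ‖g 0‖ₑ ^ p * W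
        + ∫⁻ z in disk, ‖g z - g 0‖ₑ ^ p * ENNReal.ofReal (wt z ^ γ) ∂areaMeasure := by
        rw [lintegral_add_left (by fun_prop), lintegral_const_mul' _ _ (by finiteness)]
    _ ≤ W * ‖g 0‖ₑ ^ p + C₁ * C₂ * I := by
        rw [mul_comm W]
        gcongr
    _ ≤ _ := by
        rw [ENNReal.coe_add, ENNReal.coe_toNNReal hfin.ne, ENNReal.coe_mul, mul_add]
        gcongr
        · exact le_self_add
        · exact le_add_self

/-! ### Kernel-weighted integrals of |f|^p -/

lemma deriv_comp_moebius {f : ℂ → ℂ} (hf : f ∈ holo) {a w : ℂ} (ha : a ∈ disk) (hw : w ∈ disk) :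
    ‖deriv (fun w => f (moebius a w)) w‖ₑ
      = ‖deriv f (moebius a w)‖ₑ * ENNReal.ofReal (wt a / ker a w ^ 2) := by
  have h1 : HasDerivAt f (deriv f (moebius a w)) (moebius a w) :=
    (hf.differentiableAt (isOpen_disk.mem_nhds (moebius_mem_disk ha hw))).hasDerivAt
  have h2 := (h1.comp w (hasDerivAt_moebius ha hw)).deriv
  rw [show (fun w => f (moebius a w)) = f ∘ moebius a from rfl, h2, enorm_mul]
  congr 1
  rw [← ofReal_norm, norm_div, norm_neg, norm_pow, Complex.norm_real,
    Real.norm_of_nonneg (wt_pos ha).le]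
  rfl

lemma lintegral_deriv_comp_moebius {f : ℂ → ℂ} (hf : f ∈ holo) {a : ℂ} (ha : a ∈ disk)
    {p : ℝ} (hp : 0 < p) (γ : ℝ) :
    ∫⁻ w in disk, ‖deriv (fun w => f (moebius a w)) w‖ₑ ^ p
        * ENNReal.ofReal (wt w ^ (γ + p)) ∂areaMeasure
      = ∫⁻ z in disk, ‖deriv f z‖ₑ ^ p * ENNReal.ofReal
          (wt a ^ (γ + 2) * wt z ^ (γ + p) * ker a z ^ (-2 * γ - 4)) ∂areaMeasure := by
  rw [lintegral_moebius ha (fun z => ‖deriv f z‖ₑ ^ p * ENNReal.ofReal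
          (wt a ^ (γ + 2) * wt z ^ (γ + p) * ker a z ^ (-2 * γ - 4)))]
  refine setLIntegral_congr_fun measurableSet_disk fun w hw => ?_
  have hx := wt_pos ha
  have hy := wt_pos hw
  have hk := ker_pos ha hw
  rw [deriv_comp_moebius hf ha hw, ENNReal.mul_rpow_of_nonneg _ _ hp.le,
    ENNReal.ofReal_rpow_of_nonneg (by positivity) hp.le, mul_assoc, mul_assoc,
    ← ENNReal.ofReal_mul (by positivity), wt_moebius ha hw, ker_moebius ha hw,
    ← ENNReal.ofReal_mul (by positivity), jac]
  congr 2
  obtain ⟨X, hX⟩ := exists_exp_eq hx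
  obtain ⟨Y, hY⟩ := exists_exp_eq hy
  obtain ⟨K, hK⟩ := exists_exp_eq hk
  rw [hX, hY, hK]
  simp only [← Real.exp_nat_mul, ← Real.exp_add, ← Real.exp_sub, ← Real.exp_mul]
  congr 1; push_cast; ring

lemma fSeminorm_le_fNorm (p q s : ℝ) (f : ℂ → ℂ) : fSeminorm p q s f ≤ fNorm p q s f := le_add_self

lemma add_rpow_le_two_rpow_mul (x y : ℝ≥0∞) {p : ℝ} (hp : 0 ≤ p) :
    (x + y) ^ p ≤ 2 ^ p * (x ^ p + y ^ p) := by
  calc (x + y) ^ p ≤ (2 * max x y) ^ p := by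
        refine ENNReal.rpow_le_rpow ?_ hp
        rw [two_mul]
        gcongr
        · exact le_max_left _ _
        · exact le_max_right _ _
    _ = 2 ^ p * max x y ^ p := ENNReal.mul_rpow_of_nonneg _ _ hp
    _ ≤ _ := by
        gcongr
        rcases le_total x y with h | h
        · rw [max_eq_right h]; exact le_add_self
        · rw [max_eq_left h]; exact le_self_add

/-- Pointwise growth replaces |f|^p by (1-|z|²)^{p-pα}; the remaining weight has exponent s + p - 2
> -1, so Forelli–Rudin applies. -/
lemma exists_lintegral_rpow_ker_le_of_one_lt (p s α c : ℝ) (hp : 0 < p) (hα : 1 < α)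
    (hps : 1 < s + p) (hc : 2 * (s + p * α) ≤ c) :
    ∃ C : ℝ≥0, ∀ f ∈ fSpace p (p * α - 2) s, ∀ a ∈ disk,
      ∫⁻ z in disk, ‖f z‖ₑ ^ p *
          ENNReal.ofReal (wt z ^ (s + p * α - 2) * ker a z ^ (-c)) ∂areaMeasure
        ≤ C * ENNReal.ofReal (wt a ^ (s + p - c)) * fNorm p (p * α - 2) s f ^ p := by
  obtain ⟨C₁, hC₁⟩ := exists_enorm_rpow_le_fNorm p s α hp hα
  obtain ⟨C₂, hC₂⟩ := exists_lintegral_ker_le (s + p - 2) c (by linarith) (by nlinarith)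
  refine ⟨C₁ * C₂, fun f hf a ha => ?_⟩
  have hN := ENNReal.rpow_ne_top_of_nonneg hp.le (fNorm_lt_top hf).ne
  set N := fNorm p (p * α - 2) s f ^ p
  calc _ ≤ ∫⁻ z in disk, (C₁ * N) *
          ENNReal.ofReal (wt z ^ (s + p - 2) * ker a z ^ (-c)) ∂areaMeasure := by
        refine setLIntegral_mono' measurableSet_disk fun z hz => ?_
        have hy := wt_pos hz
        calc _ ≤ (C₁ * ENNReal.ofReal (wt z ^ (p - p * α)) * N)
              * ENNReal.ofReal (wt z ^ (s + p * α - 2) * ker a z ^ (-c)) := by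
              gcongr; exact hC₁ f hf z hz
          _ = (C₁ * N) * (ENNReal.ofReal (wt z ^ (p - p * α))
              * ENNReal.ofReal (wt z ^ (s + p * α - 2) * ker a z ^ (-c))) := by ring
          _ = _ := by
              rw [← ENNReal.ofReal_mul (by positivity), ← mul_assoc, ← Real.rpow_add hy]
              congr 4; ring
    _ ≤ (C₁ * N) * (C₂ * ENNReal.ofReal (wt a ^ (s + p - c))) := by
        rw [lintegral_const_mul' _ _ (by finiteness)]
        gcongr
        refine (hC₂ a ha).trans (le_of_eq ?_)
        congr 3; ring
    _ = _ := by rw [ENNReal.coe_mul]; ring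

/-- After transport back to z, the extra (1-|z|²)^p is traded for (2|1 - conj a z|)^p. The remaining
kernel exponent 2(s + pα) - p is still at least 2s, as `lintegral_deriv_ker_le` needs. -/
lemma lintegral_deriv_comp_moebius_le {p s α : ℝ} (hp : 0 < p) (hα : 1 < α) {f : ℂ → ℂ}
    (hf : f ∈ holo) {a : ℂ} (ha : a ∈ disk) :
    ∫⁻ w in disk, ‖deriv (fun w => f (moebius a w)) w‖ₑ ^ p
        * ENNReal.ofReal (wt w ^ (s + p * α - 2 + p)) ∂areaMeasure
      ≤ ENNReal.ofReal (2 ^ (2 * (p * α)) * wt a ^ (p - p * α))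
        * fSeminorm p (p * α - 2) s f ^ p := by
  have hx := wt_pos ha
  rw [lintegral_deriv_comp_moebius hf ha hp]
  calc _ ≤ ENNReal.ofReal (2 ^ p * wt a ^ (s + p * α)) * ∫⁻ z in disk, ‖deriv f z‖ₑ ^ p *
        ENNReal.ofReal (wt z ^ (s + p * α - 2) * ker a z ^ (-(2 * (s + p * α) - p)))
          ∂areaMeasure := by
        rw [← lintegral_const_mul' _ _ ENNReal.ofReal_ne_top]
        refine setLIntegral_mono' measurableSet_disk fun z hz => ?_
        have hy := wt_pos hz
        have hk := ker_pos ha hz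
        rw [mul_left_comm, ← ENNReal.ofReal_mul (by positivity)]
        refine mul_le_mul_right (ENNReal.ofReal_le_ofReal ?_) _
        have h1 := Real.rpow_le_rpow hy.le (wt_le_two_ker' ha hz) hp.le
        rw [Real.mul_rpow (by norm_num) hk.le] at h1
        rw [Real.rpow_add hy, show s + p * α - 2 + 2 = s + p * α by ring,
          show -(2 * (s + p * α) - p) = -2 * (s + p * α - 2) - 4 + p by ring, Real.rpow_add hk]
        calc _ ≤ wt a ^ (s + p * α) * (wt z ^ (s + p * α - 2) * (2 ^ p * ker a z ^ p))
              * ker a z ^ (-2 * (s + p * α - 2) - 4) := by gcongr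
          _ = _ := by ring
    _ ≤ _ := mul_le_mul_right (lintegral_deriv_ker_le hp α (by nlinarith) f ha) _
    _ = _ := by
        rw [← mul_assoc, ← ENNReal.ofReal_mul (by positivity), mul_mul_mul_comm,
          ← Real.rpow_add hx, ← Real.rpow_add two_pos]
        congr 4 <;> ring_nf

/-- Hardy–Littlewood for f ∘ φ_a splits the integral into |f(a)|^p and a derivative integral, both
O((1-|a|²)^{p-pα}); the substitution supplies the factor (1-|a|²)^{s+pα-c}. -/
lemma exists_lintegral_rpow_ker_le_of_le_one (p s α c : ℝ) (hp : 0 < p) (hp1 : p ≤ 1) (hα : 1 < α)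
    (hsp : 1 < s + p * α) (hc : 2 * (s + p * α) ≤ c) :
    ∃ C : ℝ≥0, ∀ f ∈ fSpace p (p * α - 2) s, ∀ a ∈ disk,
      ∫⁻ z in disk, ‖f z‖ₑ ^ p *
          ENNReal.ofReal (wt z ^ (s + p * α - 2) * ker a z ^ (-c)) ∂areaMeasure
        ≤ C * ENNReal.ofReal (wt a ^ (s + p - c)) * fNorm p (p * α - 2) s f ^ p := by
  obtain ⟨C₁, hC₁⟩ := exists_enorm_rpow_le_fNorm p s α hp hα
  obtain ⟨C₂, hC₂⟩ := exists_lintegral_rpow_le p (s + p * α - 2) hp hp1 (by linarith)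
  refine ⟨Real.toNNReal (2 ^ (c - 2 * (s + p * α - 2) - 4)) * C₂
    * (C₁ + Real.toNNReal (2 ^ (2 * (p * α)))), fun f hf a ha => ?_⟩
  have hx := wt_pos ha
  set N := fNorm p (p * α - 2) s f with hN
  have h1 := lintegral_rpow_ker_le_comp_moebius f ha p (γ := s + p * α - 2) (c := c) (by linarith)
  have h2 := hC₂ _ (differentiableOn_comp_moebius hf.1 ha)
  rw [moebius_zero] at h2
  have h3 := lintegral_deriv_comp_moebius_le (s := s) hp hα hf.1 ha
  have h4 : fSeminorm p (p * α - 2) s f ^ p ≤ N ^ p :=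
    ENNReal.rpow_le_rpow (fSeminorm_le_fNorm _ _ _ _) hp.le
  calc _ ≤ _ := h1
    _ ≤ ENNReal.ofReal (2 ^ (c - 2 * (s + p * α - 2) - 4) * wt a ^ (s + p * α - 2 + 2 - c))
        * (C₂ * (C₁ * ENNReal.ofReal (wt a ^ (p - p * α)) * N ^ p
          + ENNReal.ofReal (2 ^ (2 * (p * α)) * wt a ^ (p - p * α)) * N ^ p)) := by
        gcongr
        refine h2.trans ?_
        gcongr
        · exact hC₁ f hf a ha
        · exact h3.trans (by gcongr)
    _ = ENNReal.ofReal (2 ^ (c - 2 * (s + p * α - 2) - 4)) * C₂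
        * (C₁ + ENNReal.ofReal (2 ^ (2 * (p * α))))
        * (ENNReal.ofReal (wt a ^ (s + p * α - 2 + 2 - c)) * ENNReal.ofReal (wt a ^ (p - p * α)))
        * N ^ p := by
        rw [ENNReal.ofReal_mul (by positivity), ENNReal.ofReal_mul (by positivity)]
        ring
    _ = _ := by
        rw [← ENNReal.ofReal_mul (by positivity), ← Real.rpow_add hx,
          show s + p * α - 2 + 2 - c + (p - p * α) = s + p - c by ring]
        simp only [ENNReal.coe_mul, ENNReal.coe_add]
        rfl

lemma exists_lintegral_rpow_ker_le (p s α c : ℝ) (hp : 0 < p) (hs : 0 < s) (hα : 1 < α)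
    (hsp : 1 < s + p * α) (hc : 2 * (s + p * α) ≤ c) :
    ∃ C : ℝ≥0, ∀ f ∈ fSpace p (p * α - 2) s, ∀ a ∈ disk,
      ∫⁻ z in disk, ‖f z‖ₑ ^ p *
          ENNReal.ofReal (wt z ^ (s + p * α - 2) * ker a z ^ (-c)) ∂areaMeasure
        ≤ C * ENNReal.ofReal (wt a ^ (s + p - c)) * fNorm p (p * α - 2) s f ^ p := by
  rcases le_or_gt p 1 with h | h
  · exact exists_lintegral_rpow_ker_le_of_le_one p s α c hp h hα hsp hc
  · exact exists_lintegral_rpow_ker_le_of_one_lt p s α c hp hα (by linarith) hc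

/-! ### Dirichlet norm of the test functions -/

lemma enorm_deriv_div_pow_rpow_le {f : ℂ → ℂ} (hf : f ∈ holo) {a z : ℂ} (ha : a ∈ disk)
    (hz : z ∈ disk) (n : ℕ) {p : ℝ} (hp : 0 < p) :
    ‖deriv (fun z => f z / (1 - (starRingEnd ℂ) a * z) ^ n) z‖ₑ ^ p
      ≤ 2 ^ p * (‖deriv f z‖ₑ ^ p * ENNReal.ofReal (ker a z ^ (-(n * p)))
        + (n : ℝ≥0∞) ^ p * (‖f z‖ₑ ^ p * ENNReal.ofReal (ker a z ^ (-((n + 1) * p))))) := by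
  have h0 := one_sub_conj_mul_ne_zero ha hz
  have h1 : HasDerivAt f (deriv f z) z :=
    (hf.differentiableAt (isOpen_disk.mem_nhds hz)).hasDerivAt
  have h2 := (((hasDerivAt_id z).const_mul ((starRingEnd ℂ) a)).const_sub 1).pow n
  have h3 := (h1.div h2 (pow_ne_zero n h0)).deriv
  have e : deriv (fun z => f z / (1 - (starRingEnd ℂ) a * z) ^ n) z
      = deriv f z / (1 - (starRingEnd ℂ) a * z) ^ n
        + n * (starRingEnd ℂ) a * (f z / (1 - (starRingEnd ℂ) a * z) ^ (n + 1)) := by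
    refine h3.trans ?_
    -- The power rule produces the truncated exponent `n - 1`, so n = 0 is treated separately.
    rcases n with _ | n
    · simp
    · simp only [id, Nat.add_sub_cancel, Pi.pow_apply]
      field_simp
      ring
  rw [e]
  refine (ENNReal.rpow_le_rpow (enorm_add_le _ _) hp.le).trans
    ((add_rpow_le_two_rpow_mul _ _ hp.le).trans (mul_le_mul_right ?_ _))
  rw [enorm_div_pow_rpow _ ha hz n hp.le]
  gcongr
  rw [enorm_mul, ENNReal.mul_rpow_of_nonneg _ _ hp.le,
    enorm_div_pow_rpow _ ha hz (n + 1) hp.le, Nat.cast_succ]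
  gcongr
  rw [enorm_mul]
  have h5 : ‖(starRingEnd ℂ) a‖ₑ ≤ 1 := by
    rw [← ofReal_norm, ENNReal.ofReal_le_one, Complex.norm_conj]
    exact (mem_disk.1 ha).le
  have h6 : ‖(n : ℂ)‖ₑ = n := by
    rw [← ofReal_norm]; simp
  rw [h6]
  exact mul_le_of_le_one_right' h5

/-- Both terms of the quotient rule give (1-|a|²)^{s-np}: the f' term with kernel exponent np, the f
term with (n+1)p, since s + p - (n+1)p = s - np. -/
lemma exists_dirichletNorm_div_pow_le (p s α : ℝ) (n : ℕ) (hp : 0 < p) (hs : 0 < s) (hα : 1 < α)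
    (hsp : 1 < s + p * α) (hn : 2 * (s + p * α) ≤ n * p) :
    ∃ C : ℝ≥0, ∀ f ∈ fSpace p (p * α - 2) s, ∀ a ∈ disk,
      dirichletNorm p (s + p * α - 2) (fun z => f z / (1 - (starRingEnd ℂ) a * z) ^ n) ^ p
        ≤ C * ENNReal.ofReal (wt a ^ (s - n * p)) * fNorm p (p * α - 2) s f ^ p := by
  obtain ⟨C, hC⟩ := exists_lintegral_rpow_ker_le p s α ((n + 1) * p) hp hs hα hsp (by linarith)
  have hpα : 0 < p * α := by positivity
  set γ := s + p * α - 2 with hγ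
  set K : ℝ≥0∞ := 2 ^ p * (1 + ENNReal.ofReal (γ + 1) * (2 ^ p *
    (ENNReal.ofReal (2 ^ (n * p - 2 * s)) + (n : ℝ≥0∞) ^ p * C))) with hK
  have hKtop : K ≠ ∞ := by
    have h1 : (n : ℝ≥0∞) ^ p ≠ ∞ := ENNReal.rpow_ne_top_of_nonneg hp.le (ENNReal.natCast_ne_top n)
    have h2 : (2 : ℝ≥0∞) ^ p ≠ ∞ := ENNReal.rpow_ne_top_of_nonneg hp.le (by simp)
    finiteness
  refine ⟨K.toNNReal, fun f hf a ha => ?_⟩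
  have hx := wt_pos ha
  rw [ENNReal.coe_toNNReal hKtop]
  set N := fNorm p (p * α - 2) s f with hN
  set W := ENNReal.ofReal (wt a ^ (s - n * p)) with hW
  have hS : fSeminorm p (p * α - 2) s f ^ p ≤ N ^ p :=
    ENNReal.rpow_le_rpow (fSeminorm_le_fNorm _ _ _ _) hp.le
  -- The test function takes the value f(0) at 0, and W ≥ 1 because s - np ≤ 0.
  have h0 : ‖f 0‖ₑ ^ p ≤ W * N ^ p := by
    have h1 : ‖f 0‖ₑ ^ p ≤ N ^ p := ENNReal.rpow_le_rpow le_self_add hp.le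
    refine h1.trans (le_mul_of_one_le_left' ?_)
    rw [hW, ENNReal.one_le_ofReal]
    exact Real.one_le_rpow_of_pos_of_le_one_of_nonpos hx (wt_le_one a) (by linarith)
  have hd : dirichletIntegral p γ (fun z => f z / (1 - (starRingEnd ℂ) a * z) ^ n)
      ≤ ENNReal.ofReal (γ + 1) * (2 ^ p *
        (ENNReal.ofReal (2 ^ (n * p - 2 * s)) + (n : ℝ≥0∞) ^ p * C)) * (W * N ^ p) := by
    have hm : AEMeasurable f (areaMeasure.restrict disk) :=
      hf.1.continuousOn.aemeasurable measurableSet_disk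
    have hmw := measurable_wt
    have hmk := measurable_ker a
    have hmd := measurable_deriv f
    have hn1 : (n : ℝ≥0∞) ^ p ≠ ∞ := ENNReal.rpow_ne_top_of_nonneg hp.le (ENNReal.natCast_ne_top n)
    calc _ ≤ ∫⁻ z in disk, (ENNReal.ofReal (γ + 1) * 2 ^ p) *
          (‖deriv f z‖ₑ ^ p * ENNReal.ofReal (wt z ^ γ * ker a z ^ (-(n * p)))
            + (n : ℝ≥0∞) ^ p * (‖f z‖ₑ ^ p *
              ENNReal.ofReal (wt z ^ γ * ker a z ^ (-((n + 1) * p))))) ∂areaMeasure := by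
          refine setLIntegral_mono' measurableSet_disk fun z hz => ?_
          have hy := wt_pos hz
          change _ * ENNReal.ofReal ((γ + 1) * wt z ^ γ) ≤ _
          refine (mul_le_mul_left (enorm_deriv_div_pow_rpow_le hf.1 ha hz n hp) _).trans
            (le_of_eq ?_)
          rw [ENNReal.ofReal_mul (p := γ + 1) (by linarith),
            ENNReal.ofReal_mul (p := wt z ^ γ) (by positivity),
            ENNReal.ofReal_mul (p := wt z ^ γ) (by positivity)]
          ring
      _ = (ENNReal.ofReal (γ + 1) * 2 ^ p) *
          ((∫⁻ z in disk, ‖deriv f z‖ₑ ^ p *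
              ENNReal.ofReal (wt z ^ γ * ker a z ^ (-(n * p))) ∂areaMeasure)
            + (n : ℝ≥0∞) ^ p * ∫⁻ z in disk, ‖f z‖ₑ ^ p *
              ENNReal.ofReal (wt z ^ γ * ker a z ^ (-((n + 1) * p))) ∂areaMeasure) := by
          rw [lintegral_const_mul' _ _ (by finiteness), lintegral_add_left (by fun_prop),
            lintegral_const_mul' _ _ hn1]
      _ ≤ (ENNReal.ofReal (γ + 1) * 2 ^ p) * (ENNReal.ofReal (2 ^ (n * p - 2 * s)) * W * N ^ p
            + (n : ℝ≥0∞) ^ p * (C * W * N ^ p)) := by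
          gcongr
          · refine (lintegral_deriv_ker_le hp α (by linarith) f ha).trans ?_
            rw [ENNReal.ofReal_mul (by positivity)]
            gcongr
          · refine (hC f hf a ha).trans (le_of_eq ?_)
            rw [hW, show s + p - (n + 1) * p = s - n * p by ring]
      _ = _ := by ring
  calc _ ≤ 2 ^ p * (‖f 0‖ₑ ^ p
        + dirichletIntegral p γ (fun z => f z / (1 - (starRingEnd ℂ) a * z) ^ n)) := by
        refine (add_rpow_le_two_rpow_mul _ _ hp.le).trans (le_of_eq ?_)
        rw [← ENNReal.rpow_mul, one_div_mul_cancel hp.ne', ENNReal.rpow_one]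
        simp
    _ ≤ 2 ^ p * (W * N ^ p + ENNReal.ofReal (γ + 1) * (2 ^ p *
        (ENNReal.ofReal (2 ^ (n * p - 2 * s)) + (n : ℝ≥0∞) ^ p * C)) * (W * N ^ p)) := by
        gcongr
    _ = _ := by rw [hK]; ring

/-! ### Carleson boxes and the choice of a -/

lemma measurableSet_carlesonBox (θ h : ℝ) : MeasurableSet (carlesonBox θ h) := by
  have h1 : IsCompact (arc θ h) := isCompact_Icc.image (by fun_prop)
  have h2 : Measurable fun z : ℂ => z / (‖z‖ : ℂ) := by fun_prop
  exact (measurableSet_lt measurable_const measurable_norm).inter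
    ((measurableSet_lt measurable_norm measurable_const).inter (h2 h1.measurableSet))

lemma carlesonBox_subset_disk (θ h : ℝ) : carlesonBox θ h ⊆ disk := fun _ hz => mem_disk.2 hz.2.1

/-- A point of the disk associated with the arc `arc θ h`. -/
def boxPoint (θ h : ℝ) : ℂ := ((1 - h : ℝ) : ℂ) * Complex.exp (θ * Complex.I)

lemma norm_boxPoint {θ h : ℝ} (hh : h ∈ Set.Ioc (0 : ℝ) 1) : ‖boxPoint θ h‖ = 1 - h := by
  rw [boxPoint, norm_mul, Complex.norm_exp_ofReal_mul_I, mul_one, Complex.norm_real,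
    Real.norm_of_nonneg (by linarith [hh.2])]

lemma boxPoint_mem_disk {θ h : ℝ} (hh : h ∈ Set.Ioc (0 : ℝ) 1) : boxPoint θ h ∈ disk := by
  rw [mem_disk, norm_boxPoint hh]; linarith [hh.1]

lemma le_wt_boxPoint {θ h : ℝ} (hh : h ∈ Set.Ioc (0 : ℝ) 1) : h ≤ wt (boxPoint θ h) := by
  rw [wt, norm_boxPoint hh]; nlinarith [hh.1, hh.2]

/-- The radial defect 1 - (1-h)|z| is at most 2h and the angular one at most 2πh; their sum is below
10h since π < 4. -/
lemma ker_boxPoint_le {θ h : ℝ} (hh : h ∈ Set.Ioc (0 : ℝ) 1) {z : ℂ} (hz : z ∈ carlesonBox θ h) :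
    ker (boxPoint θ h) z ≤ 10 * h := by
  obtain ⟨h1, h2, t, ht, hzt⟩ := hz
  have hz0 : 0 < ‖z‖ := by linarith [hh.2]
  set r := ‖z‖ with hr
  have hze : z = r * Complex.exp (t * Complex.I) := by
    have : (r : ℂ) ≠ 0 := by exact_mod_cast hz0.ne'
    have h3 : Complex.exp (t * Complex.I) = z / r := hzt
    rw [h3]; field_simp
  have e : (starRingEnd ℂ) (boxPoint θ h) * z
      = (((1 - h) * r : ℝ) : ℂ) * Complex.exp (Complex.I * (t - θ : ℝ)) := by
    rw [hze, boxPoint, map_mul, Complex.conj_ofReal, ← Complex.exp_conj, map_mul,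
      Complex.conj_ofReal, Complex.conj_I, mul_mul_mul_comm, ← Complex.exp_add]
    push_cast
    congr 2; ring
  have h4 : ‖Complex.exp (Complex.I * (t - θ : ℝ)) - 1‖ ≤ 2 * Real.pi * h := by
    refine Real.norm_exp_I_mul_ofReal_sub_one_le.trans ?_
    rw [Real.norm_of_nonneg (by linarith [ht.1])]
    linarith [ht.2]
  have hq0 : 0 ≤ (1 - h) * r := mul_nonneg (by linarith [hh.2]) hz0.le
  have hq1 : (1 - h) * r ≤ 1 := by nlinarith [hh.1, hh.2]
  unfold ker
  rw [e]
  calc ‖1 - (((1 - h) * r : ℝ) : ℂ) * Complex.exp (Complex.I * (t - θ : ℝ))‖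
      = ‖((1 - (1 - h) * r : ℝ) : ℂ)
        - (((1 - h) * r : ℝ) : ℂ) * (Complex.exp (Complex.I * (t - θ : ℝ)) - 1)‖ := by
        congr 1; push_cast; ring
    _ ≤ (1 - (1 - h) * r) + (1 - h) * r * (2 * Real.pi * h) := by
        refine (norm_sub_le _ _).trans ?_
        rw [norm_mul, Complex.norm_real, Complex.norm_real, Real.norm_of_nonneg hq0,
          Real.norm_of_nonneg (by linarith)]
        gcongr
    _ ≤ 2 * h + 2 * Real.pi * h := by
        have := Real.pi_pos
        have h5 : (1 - h) * r * (2 * Real.pi * h) ≤ 1 * (2 * Real.pi * h) := by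
          have := hh.1
          gcongr
        nlinarith [hh.1, hh.2]
    _ ≤ 10 * h := by nlinarith [Real.pi_lt_four, hh.1]

lemma setLIntegral_carlesonBox_le (μ : Measure ℂ) (f : ℂ → ℂ) {p : ℝ} (hp : 0 < p) (n : ℕ)
    {θ h : ℝ} (hh : h ∈ Set.Ioc (0 : ℝ) 1) :
    ∫⁻ z in carlesonBox θ h, ‖f z‖ₑ ^ p ∂μ
      ≤ ENNReal.ofReal ((10 * h) ^ (n * p)) * ∫⁻ z in disk,
        ‖f z / (1 - (starRingEnd ℂ) (boxPoint θ h) * z) ^ n‖ₑ ^ p ∂μ := by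
  have ha := boxPoint_mem_disk (θ := θ) hh
  rw [← lintegral_const_mul' _ _ ENNReal.ofReal_ne_top]
  refine le_trans ?_ (lintegral_mono_set (carlesonBox_subset_disk θ h))
  refine setLIntegral_mono' (measurableSet_carlesonBox θ h) fun z hz => ?_
  have hzd := carlesonBox_subset_disk θ h hz
  have hk := ker_pos ha hzd
  have hk2 := ker_boxPoint_le hh hz
  have hh1 := hh.1
  rw [enorm_div_pow_rpow f ha hzd n hp.le, mul_left_comm, ← ENNReal.ofReal_mul (by positivity)]
  refine le_mul_of_one_le_right' ?_
  rw [ENNReal.one_le_ofReal, Real.rpow_neg hk.le, ← div_eq_mul_inv, one_le_div (by positivity)]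
  gcongr

end DiskSpaces

end

/-! ### The embedding theorem -/

theorem mainTheorem4 (p s α : ℝ) (hp : 0 < p) (hs : 0 < s) (hα : 1 < α)
    (hsp : 1 < s + p * α)
    (μ : MeasureTheory.Measure ℂ) [MeasureTheory.IsFiniteMeasure μ]
    (hμD : μ DiskSpaces.diskᶜ = 0)
    (hμ : DiskSpaces.IsCarlesonDirichlet p (s + p * α - 2) μ) :
    DiskSpaces.IsBoundedEmbedding p (p * α - 2) s μ := by
  open DiskSpaces in
  obtain ⟨C₀, hC₀⟩ := hμ
  -- The power n depends only on p, s and α, so the constants are uniform over arcs and functions.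
  obtain ⟨n, hn⟩ := exists_nat_ge (2 * (s + p * α) / p)
  rw [div_le_iff₀ hp] at hn
  obtain ⟨C₁, hC₁⟩ := exists_dirichletNorm_div_pow_le p s α n hp hs hα hsp hn
  set C : ℝ≥0 := Real.toNNReal (10 ^ (n * p)) * (C₀ * C₁) with hC
  have hbound : ∀ f ∈ fSpace p (p * α - 2) s,
      tentNorm p s μ f ≤ (C ^ (1 / p) : ℝ≥0) * fNorm p (p * α - 2) s f := by
    intro f hf
    have hN := (fNorm_lt_top hf).ne
    set N := fNorm p (p * α - 2) s f with hNdef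
    have key : ∀ θ : ℝ, ∀ h ∈ Set.Ioc (0 : ℝ) 1,
        ENNReal.ofReal (h ^ (-s)) * ∫⁻ z in carlesonBox θ h, ‖f z‖ₑ ^ p ∂μ ≤ C * N ^ p := by
      intro θ h hh
      have hh0 := hh.1
      have ha := boxPoint_mem_disk (θ := θ) hh
      have hF := hC₁ f hf _ ha
      set F : ℂ → ℂ := fun z => f z / (1 - (starRingEnd ℂ) (boxPoint θ h) * z) ^ n with hFdef
      have hFmem : F ∈ dirichletSpace p (s + p * α - 2) := by
        refine ⟨differentiableOn_div_pow hf.1 ha n, ?_⟩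
        rw [← ENNReal.rpow_lt_top_iff_of_pos hp]
        refine hF.trans_lt ?_
        have := ENNReal.rpow_ne_top_of_nonneg hp.le hN
        exact ENNReal.mul_lt_top (ENNReal.mul_lt_top ENNReal.coe_lt_top ENNReal.ofReal_lt_top)
          this.lt_top
      -- The exponent s - np is nonpositive and h ≤ 1 - |a|², so the weight can be replaced by a
      -- power of h.
      have hw : wt (boxPoint θ h) ^ (s - n * p) ≤ h ^ (s - n * p) :=
        Real.rpow_le_rpow_of_nonpos hh0 (le_wt_boxPoint hh)
          (by nlinarith [mul_pos hp (one_pos.trans hα)])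
      calc _ ≤ ENNReal.ofReal (h ^ (-s)) * (ENNReal.ofReal ((10 * h) ^ (n * p))
            * (C₀ * (C₁ * ENNReal.ofReal (h ^ (s - n * p)) * N ^ p))) := by
            gcongr
            refine (setLIntegral_carlesonBox_le μ f hp n hh).trans ?_
            gcongr
            refine (hC₀ F hFmem).trans ?_
            gcongr
            refine hF.trans ?_
            gcongr
        _ = (ENNReal.ofReal (h ^ (-s)) * ENNReal.ofReal ((10 * h) ^ (n * p))
            * ENNReal.ofReal (h ^ (s - n * p))) * (C₀ * C₁) * N ^ p := by ring
        _ = _ := by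
            rw [← ENNReal.ofReal_mul (by positivity), ← ENNReal.ofReal_mul (by positivity),
              Real.mul_rpow (by norm_num) hh0.le]
            have e : h ^ (-s) * (10 ^ (n * p) * h ^ (n * p)) * h ^ (s - n * p)
                = 10 ^ (n * p) := by
              rw [mul_left_comm, ← Real.rpow_add hh0, mul_assoc, ← Real.rpow_add hh0]
              simp
            rw [e, hC, ENNReal.coe_mul, ENNReal.coe_mul]
            rfl
    rw [tentNorm, ENNReal.coe_rpow_of_nonneg _ (by positivity)]
    calc _ ≤ (C * N ^ p) ^ (1 / p) :=
          ENNReal.rpow_le_rpow (iSup_le fun θ => iSup₂_le fun h hh => key θ h hh) (by positivity)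
      _ = _ := by
          rw [ENNReal.mul_rpow_of_nonneg _ _ (by positivity), ← ENNReal.rpow_mul,
            mul_one_div_cancel hp.ne', ENNReal.rpow_one]
  refine ⟨C ^ (1 / p), fun f hf => ⟨⟨?_, ?_⟩, hbound f hf⟩⟩
  · exact hf.1.continuousOn.aemeasurable measurableSet_disk
  · exact (hbound f hf).trans_lt (ENNReal.mul_lt_top ENNReal.coe_lt_top (fNorm_lt_top hf))
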